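/- Let $m,d,e,k$ be positive integers with $e=\gcd(m,d)=\gcd(m,2d)$ and $2\le k\le \frac{m+e}{2e}$. Let $s=(s(i))_{i\in\mathbb Z/(2^m-1)}$ be a maximum-length binary sequence of length $2^m-1$, that is, a sequence over $\mathbb F_2$ that satisfies a linear recurrence of order $m$ over $\mathbb F_2$ and has least period $2^m-1$. For $1\le j\le k-1$ let $s_j$ be the circular decimation $s_j(i)=s(f_j i)$, where the system of decimation factors $(f_1,\dots,f_{k-1})$ is one of the following three: $f_j=2^{jd}+1$ for all $j$; or $f_j=2^{(2j-1)d}+1$ for all $j$; or $f_j=2^{(\frac{m+e}{2e}-j)d}+1$ for all $j$. Let $C$ be the $\mathbb F_2$-vector space generated by all circular shifts of $s,s_1,\dots,s_{k-1}$, and for $c=(c_0,\dots,c_{2^m-2})\in C$ let $\mathrm{DC}(c)=\sum_{i=0}^{2^m-2}(-1)^{c_i}$. Then \[ \#\{c\in C\mid \mathrm{DC}(c)=-1\}=2^{mk}-1-\sum_{u=0}^{k-2}(-1)^u2^{-e(u+1)^2}\bigl(2^{m(k-u)}-2^m\bigr)\prod_{j=0}^{u-1}\bigl(2^m-2^{e(2j+1)}\bigr).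 \] Moreover, \[ \#\{c\in C\mid \mathrm{DC}(c)=-1\}\approx 2^{mk}\Bigl(1-\sum_{u=0}^{k-2}(-1)^u2^{-e(u+1)^2}\Bigr) \] in the sense that the ratio of the two sides tends to $1$ as $m\to\infty$, uniformly in all admissible $d,e,k$, in the choice among the three systems of factors, and in $s$. -/

import Mathlib

namespace GoldType

/-- The standing numerical assumptions on the positive integers `m, d, e, k`:
`e = (m, d) = (m, 2d)` and `2 ≤ k ≤ (m + e) / (2e)`. -/
structure Parameters (m d e k : ℕ) : Prop where
  m_pos : 0 < m
  d_pos : 0 < d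
  gcd_eq : e = Nat.gcd m d
  gcd_two_eq : e = Nat.gcd m (2 * d)
  two_le : 2 ≤ k
  le_bound : 2 * e * k ≤ m + e

/-- Binary sequences of length `2 ^ m - 1`, with positions read modulo `2 ^ m - 1`. -/
abbrev BinSeq (m : ℕ) : Type := ZMod (2 ^ m - 1) → ZMod 2

/-- A maximum-length binary sequence of length `2 ^ m - 1`: it is the output of a linear feedback
shift register with `m` stages (a linear recurrence of order `m` over `𝔽₂`), and its least period
is the full length `2 ^ m - 1`. -/
def IsMaxLength (m : ℕ) (s : BinSeq m) : Prop :=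
  (∃ a : Fin m → ZMod 2, ∀ i : ZMod (2 ^ m - 1),
    s (i + (m : ZMod (2 ^ m - 1))) =
      ∑ j : Fin m, a j * s (i + ((j : ℕ) : ZMod (2 ^ m - 1)))) ∧
  ∀ t : ZMod (2 ^ m - 1), (∀ i, s (i + t) = s i) → t = 0

/-- The circular shift of a sequence by `t` positions. -/
def shift {m : ℕ} (t : ZMod (2 ^ m - 1)) (s : BinSeq m) : BinSeq m := fun i => s (i + t)

/-- The circular decimation of a sequence with decimation factor `f`. -/
def decimate {m : ℕ} (f : ℕ) (s : BinSeq m) : BinSeq m :=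
  fun i => s ((f : ZMod (2 ^ m - 1)) * i)

/-- The three admissible systems of decimation factors. -/
inductive System : Type
  | consecutive
  | odd
  | descending

/-- The `j`-th decimation factor, used for `1 ≤ j ≤ k - 1` only. Under `Parameters m d e k`, the
number `(m + e) / (2 * e)` is an exact quotient and exceeds every such `j`. -/
def System.factor (m d e : ℕ) : System → ℕ → ℕ
  | .consecutive, j => 2 ^ (j * d) + 1
  | .odd, j => 2 ^ ((2 * j - 1) * d) + 1
  | .descending, j => 2 ^ (((m + e) / (2 * e) - j) * d) + 1

/-- The Gold type code: the `𝔽₂`-space generated by all circular shifts of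
`s, s₁, …, s_{k-1}`, where `s_j` is the decimation of `s` by the `j`-th factor. -/
def code (m d e k : ℕ) (S : System) (s : BinSeq m) : Submodule (ZMod 2) (BinSeq m) :=
  Submodule.span (ZMod 2)
    ({c | ∃ t, c = shift t s} ∪
      {c | ∃ t j, 1 ≤ j ∧ j ≤ k - 1 ∧ c = shift t (decimate (S.factor m d e j) s)})

/-- The DC component `∑_{i=0}^{2^m-2} (-1)^{c_i}`. -/
def dc {m : ℕ} (c : BinSeq m) : ℤ :=
  ∑ i ∈ Finset.range (2 ^ m - 1), (-1 : ℤ) ^ (c (i : ZMod (2 ^ m - 1))).val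

/-- The number of balanced codewords, that is, those with DC component `-1`. -/
noncomputable def balancedCount (m d e k : ℕ) (S : System) (s : BinSeq m) : ℕ :=
  Set.ncard {c : BinSeq m | c ∈ code m d e k S s ∧ dc c = -1}

end GoldType

/-! A maximum-length sequence is a trace sequence `i ↦ Tr (β α^i)` over a field `F` with `X = 2^m`
elements and `α` primitive. The codewords are then the functions `x ↦ Tr (b₀ x + ∑ b_j x J_j(x))` on
the nonzero `x`, each given by exactly one coefficient vector, where the `J_j` are automorphisms
over a subfield `K` with `q = 2^e` elements and `n = [F : K]` is odd. Balanced codewords correspond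
to vanishing exponential sums.

For fixed `b`, squaring the sum and averaging over `b₀` shows that it is nonzero for exactly `X /
R_b` values of `b₀`, where `R_b` is the size of the kernel of the polar operator of `b`
(`card_expSum_ne_zero_mul`). It remains to compute `∑_b X / R_b`. For `b ≠ 0` the kernel dimension
is odd and at most `2k - 3` (`exists_finrank_ker_polarOp`), so on these finitely many values `1 / R`
agrees with a combination of the products `∏_{j<u} (R - q^(2j+1))`, `u < k - 1`
(`inv_eq_sum_prod_odd`).

The averages of these products follow from those of `∏_{j<r} (R_b - q^j)`, which counts independent
`r`-tuples in the kernel. Exchanging the order of counting, `sum_prod_sub_pow` needs the number of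
`b` annihilating a given tuple `x`; by character orthogonality this is governed by a dual system,
whose only solutions for `r < k` are the symmetric `K`-matrices applied to `x` (`card_isDualTuple`).
That rigidity, like the kernel bound, rests on one fact: a nonzero operator supported on `N + 1`
consecutive powers of a generator of the Galois group has kernel of dimension at most `N`
(`finrank_ker_galoisSum_le`).

For the asymptotics, the exact formula divided by `X^k` is within `3 / X` of its main factor, which
is at least `3/8`. -/

namespace GoldType

/-! ### Change of basis between moment products. -/

open Finset

/-- Pairs `(f, F)` in the span of `∏_{j<r} (R - q^j)` and its `X`-transform, for `r < N`. -/
def momentPairs (q : ℝ) (N : ℕ) : Submodule ℝ ((ℝ → ℝ) × (ℝ → ℝ)) :=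
  Submodule.span ℝ {p | ∃ r < N, p = (fun R => ∏ j ∈ range r, (R - q ^ j),
    fun X => X⁻¹ ^ r * q ^ (r * (r + 1) / 2) * ∏ j ∈ range r, (X - q ^ j))}

lemma momentPairs_mono (q : ℝ) {N M : ℕ} (h : N ≤ M) : momentPairs q N ≤ momentPairs q M :=
  Submodule.span_mono fun _ ⟨r, hr, hp⟩ => ⟨r, hr.trans_le h, hp⟩

/-- The operator sends the `r`-th generating pair to `q^(-r)` times the `(r+1)`-th, in both
components at once. It gives a recursion on pairs without explicit `q`-binomial expansions. -/
lemma momentPairs_shift {q : ℝ} (hq : q ≠ 0) {N : ℕ} {f F : ℝ → ℝ}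
    (h : (f, F) ∈ momentPairs q N) :
    ((fun R => (R - 1) * f (R / q), fun X => q * X⁻¹ * (X - 1) * F (X / q)) :
      (ℝ → ℝ) × (ℝ → ℝ)) ∈ momentPairs q (N + 1) := by
  let T : ((ℝ → ℝ) × (ℝ → ℝ)) →ₗ[ℝ] ((ℝ → ℝ) × (ℝ → ℝ)) :=
    { toFun := fun p => (fun R => (R - 1) * p.1 (R / q), fun X => q * X⁻¹ * (X - 1) * p.2 (X / q))
      map_add' := by
        intro x y
        ext R <;> simp <;> ring
      map_smul' := by
        intro c y
        ext R <;> simp <;> ring }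
  have key : momentPairs q N ≤ (momentPairs q (N + 1)).comap T := by
    refine Submodule.span_le.2 ?_
    rintro _ ⟨r, hr, rfl⟩
    have hprod : ∀ R : ℝ, (R - 1) * ∏ j ∈ range r, (R / q - q ^ j) =
        (q ^ r)⁻¹ * ∏ j ∈ range (r + 1), (R - q ^ j) := by
      intro R
      have : ∀ j, R / q - q ^ j = q⁻¹ * (R - q ^ (j + 1)) := by
        intro j; field_simp; ring
      simp_rw [this]
      rw [prod_mul_distrib, prod_range_succ' (fun j => R - q ^ j)]
      simp; ring
    have : T (fun R => ∏ j ∈ range r, (R - q ^ j),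
        fun X => X⁻¹ ^ r * q ^ (r * (r + 1) / 2) * ∏ j ∈ range r, (X - q ^ j)) =
        (q ^ r)⁻¹ • (fun R => ∏ j ∈ range (r + 1), (R - q ^ j),
        fun X => X⁻¹ ^ (r + 1) * q ^ ((r + 1) * (r + 1 + 1) / 2) *
          ∏ j ∈ range (r + 1), (X - q ^ j)) := by
      have he : (r + 1) * (r + 1 + 1) / 2 = r * (r + 1) / 2 + (r + 1) := by
        rw [show (r + 1) * (r + 1 + 1) = r * (r + 1) + (r + 1) * 2 by ring,
          Nat.add_mul_div_right _ _ (by norm_num)]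
      ext R
      · simp [T, hprod]
      · simp only [T, LinearMap.coe_mk, AddHom.coe_mk, Prod.smul_mk, Pi.smul_apply, smul_eq_mul]
        rw [he]
        have := hprod R
        calc _ = q * R⁻¹ * (R / q)⁻¹ ^ r * q ^ (r * (r + 1) / 2) *
              ((R - 1) * ∏ j ∈ range r, (R / q - q ^ j)) := by ring
          _ = _ := by
            rw [this, inv_div, div_eq_mul_inv, mul_pow]
            field_simp
            ring
    rw [SetLike.mem_coe, Submodule.mem_comap, this]
    exact Submodule.smul_mem _ _ (Submodule.subset_span ⟨r + 1, by omega, rfl⟩)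
  exact key h

/-- Odd and even products feed each other. With `T` the operator of `momentPairs_shift`, `even_{u+1}
= q^u T(odd_u)`, while `R - q^(2u+1) = (R - 1) - (q^(2u+1) - 1)` gives `odd_{u+1} = q^u T(even_u) -
(q^(2u+1) - 1) odd_u`. Hence the simultaneous induction. -/
lemma exists_momentPairs_odd_even {q : ℝ} (hq : q ≠ 0) (u : ℕ) :
    (∃ F : ℝ → ℝ, ((fun R => ∏ j ∈ range u, (R - q ^ (2 * j + 1)), F) :
        (ℝ → ℝ) × (ℝ → ℝ)) ∈ momentPairs q (u + 1) ∧
      ∀ X ≠ 0, F X = X⁻¹ ^ u * ∏ j ∈ range u, (X - q ^ (2 * j + 1))) ∧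
    (∃ F : ℝ → ℝ, ((fun R => ∏ j ∈ range u, (R - q ^ (2 * j)), F) :
        (ℝ → ℝ) × (ℝ → ℝ)) ∈ momentPairs q (u + 1) ∧
      ∀ X ≠ 0, F X = q ^ u * X⁻¹ ^ u * ∏ j ∈ range u, (X - q ^ (2 * j))) := by
  induction u with
  | zero =>
    refine ⟨⟨fun _ => 1, Submodule.subset_span ⟨0, by simp, by simp⟩, by simp⟩,
      ⟨fun _ => 1, Submodule.subset_span ⟨0, by simp, by simp⟩, by simp⟩⟩
  | succ u ih =>
    obtain ⟨⟨F, hF, hFX⟩, ⟨F', hF', hFX'⟩⟩ := ih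
    have hev : ∀ R : ℝ, ∏ j ∈ range u, (R / q - q ^ (2 * j)) =
        q⁻¹ ^ u * ∏ j ∈ range u, (R - q ^ (2 * j + 1)) := by
      intro R
      have : ∀ j, R / q - q ^ (2 * j) = q⁻¹ * (R - q ^ (2 * j + 1)) := by
        intro j; field_simp; ring
      simp_rw [this]
      rw [prod_mul_distrib]; simp
    have hod : ∀ R : ℝ, (R - 1) * ∏ j ∈ range u, (R / q - q ^ (2 * j + 1)) =
        q⁻¹ ^ u * ∏ j ∈ range (u + 1), (R - q ^ (2 * j)) := by
      intro R
      have : ∀ j, R / q - q ^ (2 * j + 1) = q⁻¹ * (R - q ^ (2 * (j + 1))) := by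
        intro j; field_simp; ring
      simp_rw [this]
      rw [prod_mul_distrib, prod_range_succ' (fun j => R - q ^ (2 * j))]
      simp; ring
    constructor
    · refine ⟨q ^ u • (fun X => q * X⁻¹ * (X - 1) * F' (X / q)) - (q ^ (2 * u + 1) - 1) • F,
        ?_, ?_⟩
      · have := Submodule.sub_mem _ (Submodule.smul_mem _ (q ^ u) (momentPairs_shift hq hF'))
          (Submodule.smul_mem _ (q ^ (2 * u + 1) - 1)
            (momentPairs_mono q (Nat.le_succ (u + 1)) hF))
        convert this using 1
        ext R
        · simp only [Prod.smul_mk, Prod.mk_sub_mk, Pi.sub_apply, Pi.smul_apply, smul_eq_mul]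
          rw [hev, prod_range_succ]
          have : q ^ u * q⁻¹ ^ u = 1 := by rw [← mul_pow]; simp [hq]
          linear_combination (-(R - 1) * ∏ j ∈ range u, (R - q ^ (2 * j + 1))) * this
        · simp
      · intro X hX
        simp only [Pi.sub_apply, Pi.smul_apply, smul_eq_mul]
        rw [hFX X hX, hFX' _ (div_ne_zero hX hq), hev, prod_range_succ, inv_div, div_eq_mul_inv,
          mul_pow]
        generalize ∏ j ∈ range u, (X - q ^ (2 * j + 1)) = Z
        simp only [inv_pow]
        field_simp
        ring
    · refine ⟨q ^ u • (fun X => q * X⁻¹ * (X - 1) * F (X / q)), ?_, ?_⟩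
      · have := Submodule.smul_mem _ (q ^ u) (momentPairs_shift hq hF)
        convert this using 1
        ext R
        · simp only [Prod.smul_mk, Pi.smul_apply, smul_eq_mul]
          rw [hod, ← mul_assoc, ← mul_pow]
          simp [hq]
        · simp
      · intro X hX
        simp only [Pi.smul_apply, smul_eq_mul]
        rw [hFX _ (div_ne_zero hX hq)]
        calc _ = q ^ u * (q * X⁻¹ * (X / q)⁻¹ ^ u *
              ((X - 1) * ∏ j ∈ range u, (X / q - q ^ (2 * j + 1)))) := by ring
          _ = _ := by
            rw [hod, inv_div, div_eq_mul_inv, mul_pow]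
            simp only [inv_pow]
            field_simp
            ring

/-- A linear identity between moments that holds on the basis `∏_{j<r} (R - q^j)` transfers to
the products `∏_{j<u} (R - q^(2 * j + 1))`. -/
lemma sum_prod_odd_of_moments {ι : Type*} (s : Finset ι) (R : ι → ℝ) {q X : ℝ} (C : ℝ)
    (hq : q ≠ 0) (hX : X ≠ 0) {N : ℕ}
    (h : ∀ r < N, ∑ b ∈ s, ∏ j ∈ range r, (R b - q ^ j) =
      C * (X⁻¹ ^ r * q ^ (r * (r + 1) / 2) * ∏ j ∈ range r, (X - q ^ j)))
    {u : ℕ} (hu : u < N) :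
    ∑ b ∈ s, ∏ j ∈ range u, (R b - q ^ (2 * j + 1)) =
      C * (X⁻¹ ^ u * ∏ j ∈ range u, (X - q ^ (2 * j + 1))) := by
  obtain ⟨⟨F, hF, hFX⟩, -⟩ := exists_momentPairs_odd_even hq u
  rw [← hFX X hX]
  have key : ∀ p ∈ momentPairs q N, ∑ b ∈ s, p.1 (R b) = C * p.2 X := by
    intro p hp
    induction hp using Submodule.span_induction with
    | mem p hp => obtain ⟨r, hr, rfl⟩ := hp; exact h r hr
    | zero => simp
    | add p p' _ _ h1 h2 => simp [sum_add_distrib, h1, h2, mul_add]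
    | smul a p _ h1 => simp [← mul_sum, h1]; ring
  exact key _ (momentPairs_mono q hu hF)

/-- The expansion of `1 / R` in the products `∏_{j<u} (R - q^(2 * j + 1))`, with remainder. -/
lemma inv_eq_sum_prod_odd {q R : ℝ} (hq : q ≠ 0) (hR : R ≠ 0) (N : ℕ) :
    R⁻¹ = ∑ u ∈ range N, (-1) ^ u * (q ^ ((u + 1) ^ 2))⁻¹ * ∏ j ∈ range u, (R - q ^ (2 * j + 1)) +
      (-1) ^ N * (q ^ (N ^ 2))⁻¹ * (∏ j ∈ range N, (R - q ^ (2 * j + 1))) * R⁻¹ := by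
  induction N with
  | zero => simp
  | succ N ih =>
    rw [sum_range_succ, prod_range_succ]
    nth_rw 1 [ih]
    rw [show (N + 1) ^ 2 = N ^ 2 + (2 * N + 1) by ring]
    generalize ∏ j ∈ range N, (R - q ^ (2 * j + 1)) = Z
    generalize (∑ u ∈ range N, (-1) ^ u * (q ^ ((u + 1) ^ 2))⁻¹ *
      ∏ j ∈ range u, (R - q ^ (2 * j + 1))) = Y
    rw [pow_add q (N ^ 2), pow_succ (-1 : ℝ) N]
    field_simp
    ring

end GoldType

/-! ### Radicals of alternating forms and kernels of operators supported on a window. -/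

namespace GoldType

open Finset Module

/-- The dimension of a space and of the radical of an alternating form on it have the same
parity. -/
lemma even_finrank_add_finrank_radical {K V : Type*} [Field K] [AddCommGroup V] [Module K V]
    [FiniteDimensional K V] (B : LinearMap.BilinForm K V) (hB : B.IsAlt) :
    Even (finrank K V + finrank K (B.orthogonal ⊤)) := by
  -- A maximal totally isotropic `W` equals its orthogonal: since the form is alternating, any `x`
  -- orthogonal to `W` could be adjoined. The dimension formula then reads `2 dim W = dim V + dim
  -- rad`.
  obtain ⟨W, hW, hmax⟩ := (wellFounded_gt (α := Submodule K V)).has_min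
    {W | W ≤ B.orthogonal W} ⟨⊥, by simp⟩
  have hWeq : B.orthogonal W = W := by
    refine le_antisymm (fun x hx => ?_) hW
    by_contra hxW
    refine hmax (W ⊔ Submodule.span K {x}) ?_ ?_
    · rw [Set.mem_ofPred_eq]
      intro y hy
      rw [LinearMap.BilinForm.mem_orthogonal_iff] at hx ⊢
      intro z hz
      obtain ⟨w, hw, v, hv, rfl⟩ := Submodule.mem_sup.1 hy
      obtain ⟨w', hw', v', hv', rfl⟩ := Submodule.mem_sup.1 hz
      obtain ⟨a, rfl⟩ := Submodule.mem_span_singleton.1 hv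
      obtain ⟨a', rfl⟩ := Submodule.mem_span_singleton.1 hv'
      have h1 : B w' w = 0 := (LinearMap.BilinForm.mem_orthogonal_iff.1 (hW hw)) w' hw'
      have h2 : B w' x = 0 := hx w' hw'
      have h3 : B x w = 0 := hB.isRefl w x (hx w hw)
      simp [h1, h2, h3, hB x]
    · refine lt_of_le_of_ne le_sup_left fun h => hxW ?_
      rw [h]
      exact Submodule.mem_sup_right (Submodule.mem_span_singleton_self x)
  have h := LinearMap.BilinForm.finrank_add_finrank_orthogonal hB.isRefl W
  have hrad : B.orthogonal ⊤ ≤ W := by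
    rw [← hWeq]
    exact LinearMap.BilinForm.orthogonal_le le_top
  rw [hWeq, inf_eq_right.2 hrad] at h
  exact ⟨_, h.symm⟩

section Window

variable {K F : Type*} [Field K] [Field F] [Fintype F] [Algebra K F]

-- A twisted analogue of bounding the roots of a polynomial by its degree. A nonzero solution `z₀`
-- is divided out: writing `z = z₀ w`, summation by parts turns the equation into one with one term
-- fewer in `ρ w - w`, and each fibre of `w ↦ ρ w - w` has at most `|K|` elements because `ρ` fixes
-- only `K`.
open Classical in
lemma card_ker_sum_pow_le [Fintype K] (ρ : Gal(F/K)) (hρ : ∀ x, ρ x = x → x ∈ Set.range (algebraMap K F))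
    (N : ℕ) (c : ℕ → F) (hc : ∃ l ≤ N, c l ≠ 0) :
    #{z : F | ∑ l ∈ range (N + 1), c l * (ρ ^ l) z = 0} ≤ Fintype.card K ^ N := by
  induction N generalizing c with
  | zero =>
    obtain ⟨l, hl, hcl⟩ := hc
    obtain rfl : l = 0 := by omega
    refine (card_le_card (t := {0}) fun z hz => ?_).trans (by simp)
    simpa [hcl] using hz
  | succ N ih =>
    by_cases hz : ∃ z : F, z ≠ 0 ∧ ∑ l ∈ range (N + 1 + 1), c l * (ρ ^ l) z = 0
    · obtain ⟨z₀, hz₀, hker⟩ := hz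
      set D : ℕ → F := fun l => ∑ i ∈ range (l + 1), c i * (ρ ^ i) z₀ with hD
      -- If all partial sums vanished, so would each difference `c l * ρ^l z₀`, hence every `c l`.
      have hDc : ∃ l ≤ N, D l ≠ 0 := by
        by_contra! h
        obtain ⟨l, hl, hcl⟩ := hc
        have hDl : D l = 0 := by
          rcases Nat.lt_or_ge N l with h' | h'
          · obtain rfl : l = N + 1 := by omega
            exact hker
          · exact h l h'
        refine hcl ?_
        have h0 : c l * (ρ ^ l) z₀ = 0 := by
          rcases l with _ | l
          · simpa [hD] using hDl
          · have := h l (by omega)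
            simp only [hD] at hDl this
            rwa [sum_range_succ, this, zero_add] at hDl
        exact (mul_eq_zero.1 h0).resolve_right ((map_ne_zero _).2 hz₀)
      have habel : ∀ (M : ℕ) (w : F), ∑ l ∈ range (M + 1), c l * (ρ ^ l) (z₀ * w) =
          D M * (ρ ^ M) w - ∑ l ∈ range M, D l * (ρ ^ l) (ρ w - w) := by
        intro M w
        induction M with
        | zero => simp [hD]; ring
        | succ M ihM =>
          rw [sum_range_succ, ihM, sum_range_succ]
          have h1 : D (M + 1) = D M + c (M + 1) * (ρ ^ (M + 1)) z₀ := by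
            simp only [hD]; rw [sum_range_succ]
          have h2 : (ρ ^ (M + 1)) w = (ρ ^ M) (ρ w) := by
            rw [pow_succ]; rfl
          rw [h1, map_mul, map_sub, h2]
          ring
      set f : F → F := fun z => ρ (z / z₀) - z / z₀ with hf
      set s : Finset F := {z : F | ∑ l ∈ range (N + 1 + 1), c l * (ρ ^ l) z = 0} with hs
      have h1 : s.image f ⊆ ({z : F | ∑ l ∈ range (N + 1), D l * (ρ ^ l) z = 0} : Finset F) := by
        intro v hv
        obtain ⟨z, hz, rfl⟩ := mem_image.1 hv
        have hz' := (mem_filter.1 hz).2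
        have := habel (N + 1) (z / z₀)
        rw [mul_div_cancel₀ _ hz₀, hz', show D (N + 1) = 0 from hker, zero_mul, zero_sub,
          eq_comm, neg_eq_zero] at this
        exact mem_filter.2 ⟨mem_univ _, this⟩
      have h2 : #s ≤ Fintype.card K * #(s.image f) := by
        refine card_le_mul_card_image s _ fun v hv => ?_
        obtain ⟨z, hz, rfl⟩ := mem_image.1 hv
        have : ({x ∈ s | f x = f z} : Finset F) ⊆
            univ.image (fun k : K => z + z₀ * algebraMap K F k) := by
          intro x hx
          have hx' := (mem_filter.1 hx).2
          obtain ⟨k, hk⟩ := hρ (x / z₀ - z / z₀) (by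
            simp only [hf] at hx'
            rw [map_sub]
            linear_combination hx')
          refine mem_image.2 ⟨k, mem_univ _, ?_⟩
          rw [hk]
          field_simp
          ring
        exact (card_le_card this).trans (card_image_le.trans (by simp))
      calc #s ≤ Fintype.card K * #(s.image f) := h2
        _ ≤ Fintype.card K * Fintype.card K ^ N :=
          Nat.mul_le_mul_left _ ((card_le_card h1).trans (ih D hDc))
        _ = _ := by ring
    · push Not at hz
      have : ({z : F | ∑ l ∈ range (N + 1 + 1), c l * (ρ ^ l) z = 0} : Finset F) ⊆ {0} := by
        intro z h
        by_contra h'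
        exact hz z (by simpa using h') (mem_filter.1 h).2
      exact (card_le_card this).trans (by simpa using Nat.one_le_pow _ _ Fintype.card_pos)

/-- The `K`-linear operator `z ↦ ∑ g, c g * g z` attached to a function on the Galois group. -/
noncomputable def galoisSum (c : Gal(F/K) → F) : F →ₗ[K] F :=
  ∑ g, LinearMap.mulLeft K (c g) ∘ₗ g.toLinearMap

@[simp] lemma galoisSum_apply (c : Gal(F/K) → F) (z : F) :
    galoisSum c z = ∑ g, c g * g z := by
  simp [galoisSum]

/-- If the coefficients are not all zero and are supported on `N + 1` consecutive powers of a
generator of the Galois group, the kernel has dimension at most `N`. -/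
lemma finrank_ker_galoisSum_le [Fintype K] {ρ : Gal(F/K)} (hρ : ∀ g, g ∈ Subgroup.zpowers ρ)
    {c : Gal(F/K) → F} (hc : c ≠ 0) {N : ℕ} (hN : N < orderOf ρ) (w : ℤ)
    (hw : ∀ g, c g ≠ 0 → ∃ l ≤ N, g = ρ ^ (w + (l : ℤ))) :
    finrank K (LinearMap.ker (galoisSum c)) ≤ N := by
  classical
  have hfix : ∀ x, ρ x = x → x ∈ Set.range (algebraMap K F) := by
    intro x hx
    rw [IsGalois.mem_range_algebraMap_iff_fixed]
    intro g
    have : (Subgroup.zpowers ρ) ≤ MulAction.stabilizer Gal(F/K) x := by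
      rw [Subgroup.zpowers_le]; exact hx
    exact this (hρ g)
  obtain ⟨g₀, hg₀⟩ := Function.ne_iff.1 hc
  have hcard := card_ker_sum_pow_le ρ hfix N (fun l => c (ρ ^ (w + (l : ℤ)))) (by
    obtain ⟨l, hl, h⟩ := hw g₀ hg₀
    exact ⟨l, hl, by rw [← h]; exact hg₀⟩)
  -- Precomposing with the bijection `ρ^w` moves the window to start at exponent `0`; `N < orderOf
  -- ρ` keeps its powers distinct.
  have hsum : ∀ z, galoisSum c z =
      ∑ l ∈ range (N + 1), c (ρ ^ (w + (l : ℤ))) * (ρ ^ l) ((ρ ^ w) z) := by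
    intro z
    rw [galoisSum_apply]
    symm
    refine sum_of_injOn (fun l : ℕ => ρ ^ (w + (l : ℤ))) ?_ (by simp) ?_ ?_
    · intro a ha b hb hab
      simp only [zpow_add, zpow_natCast, mul_right_inj] at hab
      refine pow_injOn_Iio_orderOf ?_ ?_ hab
      · have := mem_range.1 ha; simp only [Set.mem_Iio]; omega
      · have := mem_range.1 hb; simp only [Set.mem_Iio]; omega
    · intro g _ hg
      by_contra h
      obtain ⟨l, hl, rfl⟩ := hw g (left_ne_zero_of_mul h)
      exact hg ⟨l, by simp; omega, rfl⟩
    · intro l _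
      have : ρ ^ (w + (l : ℤ)) = ρ ^ l * ρ ^ w := by
        rw [add_comm, zpow_add, zpow_natCast]
      rw [this]; rfl
  have hinj : Nat.card (LinearMap.ker (galoisSum c)) ≤ Fintype.card K ^ N := by
    refine le_trans ?_ hcard
    rw [Nat.card_eq_fintype_card, ← Finset.card_univ]
    refine card_le_card_of_injOn (fun z => (ρ ^ w) z.1) (fun z _ => ?_) (fun a _ b _ hab => ?_)
    · simp only [coe_filter, mem_univ, true_and, Set.mem_ofPred_eq]
      rw [← hsum]
      exact z.2
    · exact Subtype.ext ((ρ ^ w).injective hab)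
  rw [Module.natCard_eq_pow_finrank (K := K), Nat.card_eq_fintype_card] at hinj
  exact (Nat.pow_le_pow_iff_right Fintype.one_lt_card).1 hinj

end Window

end GoldType

/-! ### Polar operators of a Gold family and the sizes of their kernels. -/

namespace GoldType

open Finset Module

section Family

variable {K F ι : Type*} [Field K] [Field F] [Fintype F] [Algebra K F] [Fintype ι]

/-- The coefficients of the operator `x ↦ ∑ j, (b j * J j x + (J j)⁻¹ (b j * x))`. -/
noncomputable def polarCoeff (J : ι → Gal(F/K)) (b : ι → F) (g : Gal(F/K)) : F := by
  classical
  exact ∑ j, ((if g = J j then b j else 0) + (if g = (J j)⁻¹ then (J j)⁻¹ (b j) else 0))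

/-- The operator representing the polar form of the quadratic form
`x ↦ ∑ j, Tr (b j * x * J j x)`. -/
noncomputable def polarOp (J : ι → Gal(F/K)) (b : ι → F) : F →ₗ[K] F :=
  galoisSum (polarCoeff J b)

lemma polarOp_apply (J : ι → Gal(F/K)) (b : ι → F) (x : F) :
    polarOp J b x = ∑ j, (b j * J j x + (J j)⁻¹ (b j * x)) := by
  classical
  simp only [polarOp, galoisSum_apply, polarCoeff, sum_mul]
  rw [sum_comm]
  refine sum_congr rfl fun j _ => ?_
  simp [add_mul, sum_add_distrib, ite_mul]

/-- Families of Galois automorphisms whose polar operators form an optimal set of alternating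
forms: the `J i` and their inverses, as well as the remaining nontrivial automorphisms, are
confined to short intervals of powers of a generator `ρ`. -/
structure IsGoldFamily (ρ : Gal(F/K)) (J : ι → Gal(F/K)) (k : ℕ) : Prop where
  gen : ∀ g, g ∈ Subgroup.zpowers ρ
  card_add_one : Fintype.card ι + 1 = k
  two_mul_le : 2 * k ≤ finrank K F + 1
  odd_finrank : Odd (finrank K F)
  inj : Function.Injective J
  ne_inv : ∀ i j, J i ≠ (J j)⁻¹
  window : ∃ w : ℤ, ∀ i, (∃ l ≤ 2 * k - 2, J i = ρ ^ (w + (l : ℤ))) ∧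
    (∃ l ≤ 2 * k - 2, (J i)⁻¹ = ρ ^ (w + (l : ℤ)))
  cowindow : ∃ w : ℤ, ∀ g, g ≠ 1 → (∀ i, g ≠ J i) → (∀ i, g⁻¹ ≠ J i) →
    ∃ l ≤ finrank K F + 1 - 2 * k, g = ρ ^ (w + (l : ℤ))

variable {ρ : Gal(F/K)} {J : ι → Gal(F/K)} {k : ℕ}

lemma orderOf_eq_finrank_of_gen (h : ∀ g, g ∈ Subgroup.zpowers ρ) :
    orderOf ρ = finrank K F := by
  rw [orderOf_eq_card_of_forall_mem_zpowers h, IsGalois.card_aut_eq_finrank]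

lemma polarCoeff_apply_self (hJ : IsGoldFamily ρ J k) (b : ι → F) (i : ι) :
    polarCoeff J b (J i) = b i := by
  classical
  simp [polarCoeff, hJ.inj.eq_iff, hJ.ne_inv]

/-- The coefficients live on the `J i` and their inverses, which fit in one window. They are not all
zero: the coefficient at `J i` is `b i`, as no `J i` equals another `J j` or an inverse. -/
lemma finrank_ker_polarOp_le [Fintype K] (hJ : IsGoldFamily ρ J k) {b : ι → F} (hb : b ≠ 0) :
    finrank K (LinearMap.ker (polarOp J b)) ≤ 2 * k - 2 := by
  classical
  obtain ⟨w, hw⟩ := hJ.window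
  obtain ⟨i, hi⟩ := Function.ne_iff.1 hb
  have hn := hJ.two_mul_le
  have hk := hJ.card_add_one
  refine finrank_ker_galoisSum_le hJ.gen ?_ ?_ w ?_
  · intro h
    exact hi (by rw [← polarCoeff_apply_self hJ b i, h]; rfl)
  · rw [orderOf_eq_finrank_of_gen hJ.gen]
    omega
  · intro g hg
    by_contra hno
    refine hg ?_
    refine sum_eq_zero fun j _ => ?_
    rw [if_neg, if_neg, add_zero]
    · rintro rfl; exact hno (hw j).2
    · rintro rfl; exact hno (hw j).1

lemma trace_galois {K F : Type*} [Field K] [Field F] [Algebra K F] (g : Gal(F/K)) (x : F) : Algebra.trace K F (g x) = Algebra.trace K F x :=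
  Algebra.trace_eq_of_algEquiv g x

/-- The form `(x, y) ↦ Tr (L x * y)`, with `L` the polar operator, is alternating: on the diagonal
the two terms for each `j` have equal trace and cancel in characteristic two. Its radical is `ker
L`, the trace form being nondegenerate. -/
lemma even_finrank_add_finrank_ker_polarOp [CharP F 2] (J : ι → Gal(F/K)) (b : ι → F) :
    Even (finrank K F + finrank K (LinearMap.ker (polarOp J b))) := by
  have hnd := traceForm_nondegenerate K F
  set B : LinearMap.BilinForm K F := (Algebra.traceForm K F).comp (polarOp J b) LinearMap.id
    with hB
  have hBapp : ∀ x y, B x y = Algebra.trace K F (polarOp J b x * y) := fun x y => rfl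
  have hK : CharP K 2 := (algebraMap K F).charP (algebraMap K F).injective 2
  have halt : B.IsAlt := by
    intro x
    rw [hBapp, polarOp_apply, sum_mul, map_sum]
    refine sum_eq_zero fun j _ => ?_
    have h1 : (J j)⁻¹ (b j * x) * x = (J j)⁻¹ (b j * J j x * x) := by
      have : (J j)⁻¹ (J j x) = x := (J j).symm_apply_apply x
      simp only [map_mul, this]; ring
    rw [add_mul, h1, map_add, trace_galois, CharTwo.add_self_eq_zero]
  have hker : B.orthogonal ⊤ = LinearMap.ker (polarOp J b) := by
    ext x
    rw [LinearMap.BilinForm.mem_orthogonal_iff, LinearMap.mem_ker]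
    constructor
    · intro h
      refine hnd.1 _ fun y => ?_
      exact halt.isRefl y x (h y trivial)
    · intro h y _
      refine halt.isRefl x y ?_
      rw [hBapp, h, zero_mul, map_zero]
  rw [← hker]
  exact even_finrank_add_finrank_radical B halt

lemma exists_finrank_ker_polarOp [Fintype K] [CharP F 2] (hJ : IsGoldFamily ρ J k) {b : ι → F}
    (hb : b ≠ 0) :
    ∃ s, s < k - 1 ∧ finrank K (LinearMap.ker (polarOp J b)) = 2 * s + 1 := by
  obtain ⟨a, ha⟩ := even_finrank_add_finrank_ker_polarOp J b
  obtain ⟨c, hc⟩ := hJ.odd_finrank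
  have := finrank_ker_polarOp_le hJ hb
  have := hJ.card_add_one
  exact ⟨a - c - 1, by omega, by omega⟩

/-! ### The dual system -/

/-- The tuples `y` with `∑ i, (J j (x i) * y i + x i * J j (y i)) = 0` for all `j`. -/
def IsDualTuple {r : ℕ} (J : ι → Gal(F/K)) (x y : Fin r → F) : Prop :=
  ∀ j, ∑ i, (J j (x i) * y i + x i * J j (y i)) = 0

lemma isDualTuple_of_symm {K F ι : Type*} [Field K] [Field F] [Algebra K F] [CharP F 2] {r : ℕ} (J : ι → Gal(F/K)) (x : Fin r → F)
    (S : Sym2 (Fin r) → K) : IsDualTuple J x (fun i => ∑ l, S s(i, l) • x l) := by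
  intro j
  simp only [map_sum, map_smul, mul_sum, sum_add_distrib]
  rw [sum_comm (f := fun i l => x i * S s(i, l) • J j (x l)), ← sum_add_distrib]
  refine sum_eq_zero fun i _ => ?_
  rw [← sum_add_distrib]
  refine sum_eq_zero fun l _ => ?_
  rw [Sym2.eq_swap, mul_smul_comm, mul_smul_comm, mul_comm, CharTwo.add_self_eq_zero]

lemma exists_trace_dual {r : ℕ} {x : Fin r → F} (hx : LinearIndependent K x) :
    ∃ z : Fin r → F, ∀ i j, Algebra.trace K F (x i * z j) = if i = j then 1 else 0 := by
  have hinj : LinearMap.ker (Fintype.linearCombination K x) = ⊥ :=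
    LinearMap.ker_eq_bot.2 (linearIndependent_iff_injective_fintypeLinearCombination.1 hx)
  obtain ⟨φ, hφ⟩ := LinearMap.exists_leftInverse_of_injective _ hinj
  have hnd := traceForm_nondegenerate K F
  refine ⟨fun j => ((Algebra.traceForm K F).toDual hnd).symm (LinearMap.proj j ∘ₗ φ),
    fun i j => ?_⟩
  have h1 : φ (x i) = Pi.single i 1 := by
    have := LinearMap.congr_fun hφ (Pi.single i 1)
    simpa [Fintype.linearCombination_apply_single] using this
  have h2 := LinearMap.BilinForm.apply_toDual_symm_apply (B := Algebra.traceForm K F)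
    (hB := hnd) (f := LinearMap.proj j ∘ₗ φ) (x i)
  rw [Algebra.traceForm_apply, mul_comm] at h2
  rw [h2]
  simp [h1, Pi.single_apply, eq_comm]

/-- Written through traces, the operator visibly kills every `z` orthogonal to the `x i` and `y i`,
so its rank is at most `2r`. -/
lemma galoisSum_dual_apply {r : ℕ} (x y : Fin r → F) (z : F) :
    galoisSum (fun g : Gal(F/K) => ∑ i, (g (x i) * y i + x i * g (y i))) z =
      ∑ i, (Algebra.trace K F (x i * z) • y i + Algebra.trace K F (y i * z) • x i) := by
  simp only [galoisSum_apply, Algebra.smul_def, trace_eq_sum_automorphisms, sum_mul]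
  rw [sum_comm]
  refine sum_congr rfl fun i _ => ?_
  rw [← sum_add_distrib]
  refine sum_congr rfl fun g _ => ?_
  simp only [map_mul]
  ring

/-- The dual equations hold at the `J i`; they extend to the inverses by applying `g`, and to `1` by
characteristic two. What is left lies in the complementary window, so a nonzero operator would have
kernel of dimension at most `n + 1 - 2k`. Its rank is at most `2r ≤ 2k - 2`, which forces dimension
at least `n + 2 - 2k`. -/
lemma dual_coeff_eq_zero [Fintype K] [CharP F 2] (hJ : IsGoldFamily ρ J k) {r : ℕ} (hr : r < k)
    {x y : Fin r → F} (hy : IsDualTuple J x y) (g : Gal(F/K)) :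
    ∑ i, (g (x i) * y i + x i * g (y i)) = 0 := by
  set c : Gal(F/K) → F := fun g => ∑ i, (g (x i) * y i + x i * g (y i)) with hc
  change c g = 0
  suffices h : c = 0 by rw [h]; rfl
  by_contra hne
  obtain ⟨w, hw⟩ := hJ.cowindow
  have hn := hJ.two_mul_le
  have hsupp : ∀ g, c g ≠ 0 → ∃ l ≤ finrank K F + 1 - 2 * k, g = ρ ^ (w + (l : ℤ)) := by
    intro g hg
    refine hw g ?_ ?_ ?_
    · rintro rfl
      refine hg (sum_eq_zero fun i _ => ?_)
      exact CharTwo.add_self_eq_zero _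
    · rintro i rfl
      exact hg (hy i)
    · intro i hi
      have h0 : g (c (g⁻¹)) = c g := by
        have : ∀ v, g (g⁻¹ v) = v := fun v => g.apply_symm_apply v
        simp only [hc, map_sum, map_add, map_mul, this]
        refine sum_congr rfl fun i _ => ?_
        ring
      rw [hi] at h0
      rw [← h0] at hg
      exact hg (by rw [show c (J i) = 0 from hy i, map_zero])
  have hle := finrank_ker_galoisSum_le hJ.gen hne
    (by rw [orderOf_eq_finrank_of_gen hJ.gen]; omega) w hsupp
  let T : F →ₗ[K] (Fin r → K) × (Fin r → K) :=
    (LinearMap.pi fun i => Algebra.traceForm K F (x i)).prod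
      (LinearMap.pi fun i => Algebra.traceForm K F (y i))
  have hT : LinearMap.ker T ≤ LinearMap.ker (galoisSum c) := by
    intro z hz
    rw [LinearMap.mem_ker] at hz ⊢
    have h1 : ∀ i, Algebra.trace K F (x i * z) = 0 := fun i => congrFun (congrArg Prod.fst hz) i
    have h2 : ∀ i, Algebra.trace K F (y i * z) = 0 := fun i => congrFun (congrArg Prod.snd hz) i
    rw [hc, galoisSum_dual_apply]
    simp [h1, h2]
  have h1 := Submodule.finrank_mono hT
  have h2 := LinearMap.finrank_range_add_finrank_ker T
  have h3 := Submodule.finrank_le (LinearMap.range T)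
  simp only [finrank_prod, finrank_fin_fun] at h3
  omega

/-- Once all coefficients vanish, evaluating the operator at the trace-dual vectors `z j` expresses
`y j` in the `x i` with coefficients `Tr (y i * z j)`. Pairing this with `z l` shows that the matrix
is symmetric. -/
lemma exists_symm_of_isDualTuple [Fintype K] [CharP F 2] (hJ : IsGoldFamily ρ J k) {r : ℕ}
    (hr : r < k) {x y : Fin r → F} (hx : LinearIndependent K x) (hy : IsDualTuple J x y) :
    ∃ S : Sym2 (Fin r) → K, y = fun i => ∑ l, S s(i, l) • x l := by
  obtain ⟨z, hz⟩ := exists_trace_dual hx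
  have h0 : ∀ v, ∑ i, (Algebra.trace K F (x i * v) • y i + Algebra.trace K F (y i * v) • x i)
      = 0 := by
    intro v
    rw [← galoisSum_dual_apply, galoisSum_apply]
    refine sum_eq_zero fun g _ => ?_
    rw [dual_coeff_eq_zero hJ hr hy g, zero_mul]
  have h1 : ∀ j, y j = ∑ i, Algebra.trace K F (y i * z j) • x i := by
    intro j
    have := h0 (z j)
    simp only [hz, sum_add_distrib, ite_smul, one_smul, zero_smul, sum_ite_eq', mem_univ,
      if_true] at this
    exact CharTwo.add_eq_zero.1 this
  have hsymm : ∀ j l, Algebra.trace K F (y j * z l) = Algebra.trace K F (y l * z j) := by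
    intro j l
    conv_lhs => rw [h1 j]
    simp [sum_mul, hz]
  refine ⟨Sym2.lift ⟨fun i j => Algebra.trace K F (y i * z j), hsymm⟩, ?_⟩
  funext j
  simp only [Sym2.lift_mk]
  exact (h1 j).trans (sum_congr rfl fun i _ => by rw [hsymm])

lemma card_isDualTuple [Fintype K] [CharP F 2] (hJ : IsGoldFamily ρ J k) {r : ℕ}
    (hr : r < k) {x : Fin r → F} (hx : LinearIndependent K x) :
    Nat.card {y : Fin r → F // IsDualTuple J x y} = Fintype.card K ^ (r * (r + 1) / 2) := by
  have hbij : Function.Bijective (fun S : Sym2 (Fin r) → K =>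
      (⟨fun i => ∑ l, S s(i, l) • x l, isDualTuple_of_symm J x S⟩ :
        {y : Fin r → F // IsDualTuple J x y})) := by
    constructor
    · intro S S' h
      have h' := congrArg Subtype.val h
      funext p
      induction p using Sym2.ind with
      | _ i l =>
        have h2 := congrFun h' i
        exact congrFun (linearIndependent_iff_injective_fintypeLinearCombination.1 hx
          (a₁ := fun l => S s(i, l)) (a₂ := fun l => S' s(i, l))
          (by simpa [Fintype.linearCombination_apply] using h2)) l
    · rintro ⟨y, hy⟩
      obtain ⟨S, hS⟩ := exists_symm_of_isDualTuple hJ hr hx hy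
      exact ⟨S, Subtype.ext hS.symm⟩
  rw [← Nat.card_eq_of_bijective _ hbij, Nat.card_eq_fintype_card, Fintype.card_fun, Sym2.card,
    Fintype.card_fin, Nat.choose_two_right, Nat.add_sub_cancel, mul_comm r]

end Family

end GoldType

/-! ### Moments of the kernel sizes, and the sum of their reciprocals. -/

namespace GoldType

open Finset Module

lemma addChar_sum {A κ : Type*} [AddCommMonoid A] (ψ : AddChar A ℤ) (s : Finset κ) (f : κ → A) :
    ψ (∑ i ∈ s, f i) = ∏ i ∈ s, ψ (f i) := by
  classical
  induction s using Finset.induction_on with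
  | empty => simp
  | insert a s ha ih => rw [sum_insert ha, prod_insert ha, AddChar.map_add_eq_mul, ih]

lemma addChar_galois_inv {K F : Type*} [Field K] [Field F] [Algebra K F] {ψ : AddChar F ℤ}
    (hinv : ∀ (g : Gal(F/K)) x, ψ (g x) = ψ x) (g : Gal(F/K)) (u v : F) :
    ψ (u * g⁻¹ v) = ψ (g u * v) := by
  rw [← hinv g (u * g⁻¹ v), map_mul, show g (g⁻¹ v) = v from g.apply_symm_apply v]

section Moments

variable {K F ι : Type*} [Field K] [Field F] [Fintype F] [Algebra K F] [Fintype ι]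
  {ρ : Gal(F/K)} {J : ι → Gal(F/K)} {k : ℕ}

lemma sum_addChar_pi {F κ : Type*} [Field F] [Fintype F] [Fintype κ] [DecidableEq F]
    [DecidableEq κ] {ψ : AddChar F ℤ} (hψ : ψ.IsPrimitive) (z : κ → F) :
    ∑ y : κ → F, ψ (∑ i, y i * z i) = if z = 0 then (Fintype.card F : ℤ) ^ Fintype.card κ else 0 := by
  have h1 : ∀ y : κ → F, ψ (∑ i, y i * z i) = ∏ i, ψ (y i * z i) := fun y =>
    addChar_sum ψ _ _
  simp_rw [h1]
  rw [← Fintype.piFinset_univ, ← prod_univ_sum (fun _ => univ) (fun i v => ψ (v * z i))]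
  simp_rw [AddChar.sum_mulShift _ hψ]
  split_ifs with h
  · simp [h]
  · obtain ⟨i, hi⟩ := Function.ne_iff.1 h
    exact prod_eq_zero (mem_univ i) (by simpa using hi)

lemma addChar_polarOp {ψ : AddChar F ℤ} (hinv : ∀ (g : Gal(F/K)) x, ψ (g x) = ψ x)
    (b : ι → F) (x y : F) :
    ψ (y * polarOp J b x) = ψ (∑ j, b j * (J j x * y + x * J j y)) := by
  rw [polarOp_apply, mul_sum, addChar_sum, addChar_sum]
  refine prod_congr rfl fun j _ => ?_
  rw [mul_add, AddChar.map_add_eq_mul, addChar_galois_inv hinv, mul_add,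
    AddChar.map_add_eq_mul]
  congr 2 <;> ring

-- Double counting of `∑_{b,y} ψ (∑ y_i L_b(x_i))`: summing over `y` first detects `L_b(x_i) = 0`,
-- summing over `b` first detects the dual equations.
open Classical in
lemma card_polarOp_eq_zero_mul [DecidableEq ι] {ψ : AddChar F ℤ} (hψ : ψ.IsPrimitive)
    (hinv : ∀ (g : Gal(F/K)) x, ψ (g x) = ψ x) {r : ℕ} (x : Fin r → F) :
    #{b : ι → F | ∀ i, polarOp J b (x i) = 0} * Fintype.card F ^ r =
      Fintype.card F ^ Fintype.card ι * Nat.card {y : Fin r → F // IsDualTuple J x y} := by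
  have h1 : ∀ b : ι → F, ∑ y : Fin r → F, ψ (∑ i, y i * polarOp J b (x i)) =
      if ∀ i, polarOp J b (x i) = 0 then (Fintype.card F : ℤ) ^ r else 0 := by
    intro b
    rw [sum_addChar_pi hψ, Fintype.card_fin]
    simp only [funext_iff, Pi.zero_apply]
  have h2 : ∀ y : Fin r → F, ∑ b : ι → F, ψ (∑ i, y i * polarOp J b (x i)) =
      if IsDualTuple J x y then (Fintype.card F : ℤ) ^ Fintype.card ι else 0 := by
    intro y
    have : ∀ b : ι → F, ψ (∑ i, y i * polarOp J b (x i)) =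
        ψ (∑ j, b j * ∑ i, (J j (x i) * y i + x i * J j (y i))) := by
      intro b
      rw [addChar_sum]
      simp_rw [addChar_polarOp hinv]
      rw [← addChar_sum, sum_comm]
      simp_rw [mul_sum]
    simp_rw [this]
    rw [sum_addChar_pi hψ]
    simp only [funext_iff, Pi.zero_apply, IsDualTuple]
    congr
  have h3 := sum_comm (s := (univ : Finset (ι → F))) (t := (univ : Finset (Fin r → F)))
    (f := fun b y => ψ (∑ i, y i * polarOp J b (x i)))
  simp_rw [h1, h2] at h3
  rw [← sum_filter, ← sum_filter, sum_const, sum_const, nsmul_eq_mul, nsmul_eq_mul] at h3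
  rw [Nat.card_eq_fintype_card, Fintype.card_subtype, mul_comm (_ ^ Fintype.card ι)]
  exact_mod_cast h3

lemma natCard_linearIndependent_eq_prod [Fintype K] {V : Type*} [AddCommGroup V] [Module K V] [Finite V]
    (r : ℕ) : (Nat.card {s : Fin r → V // LinearIndependent K s} : ℝ) =
      ∏ j ∈ range r, ((Fintype.card K : ℝ) ^ finrank K V - (Fintype.card K : ℝ) ^ j) := by
  rcases le_or_gt r (finrank K V) with h | h
  · rw [card_linearIndependent h, Fin.prod_univ_eq_prod_range
      (fun j => Fintype.card K ^ finrank K V - Fintype.card K ^ j), Nat.cast_prod]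
    refine prod_congr rfl fun j hj => ?_
    rw [Nat.cast_sub (Nat.pow_le_pow_right Fintype.card_pos ((mem_range.1 hj).le.trans h))]
    push_cast; rfl
  · rw [prod_eq_zero (mem_range.2 h) (sub_self _)]
    have : IsEmpty {s : Fin r → V // LinearIndependent K s} := by
      refine ⟨fun s => ?_⟩
      have := s.2.fintype_card_le_finrank
      simp at this
      omega
    simp

open Classical in
lemma natCard_linearIndependent_submodule (W : Submodule K F) (r : ℕ) :
    Nat.card {s : Fin r → W // LinearIndependent K s} =
      #{x : Fin r → F | LinearIndependent K x ∧ ∀ i, x i ∈ W} := by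
  rw [← Fintype.card_subtype, ← Nat.card_eq_fintype_card]
  refine Nat.card_congr
    { toFun := fun s => ⟨fun i => s.1 i, s.2.map' W.subtype W.ker_subtype, fun i => (s.1 i).2⟩
      invFun := fun x => ⟨fun i => ⟨x.1 i, x.2.2 i⟩, .of_comp W.subtype x.2.1⟩
      left_inv := fun s => rfl
      right_inv := fun x => rfl }

/-- Both sides count pairs of a `b` and an independent `r`-tuple in its kernel; the number of `b`
per tuple does not depend on the tuple. -/
lemma sum_prod_sub_pow [DecidableEq ι] [Fintype K] [CharP F 2] (hJ : IsGoldFamily ρ J k) {ψ : AddChar F ℤ}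
    (hψ : ψ.IsPrimitive) (hinv : ∀ (g : Gal(F/K)) x, ψ (g x) = ψ x) {r : ℕ} (hr : r < k) :
    ∑ b : ι → F, ∏ j ∈ range r, ((Fintype.card K : ℝ) ^ finrank K (LinearMap.ker (polarOp J b)) -
        (Fintype.card K : ℝ) ^ j) =
      (Fintype.card F : ℝ) ^ (k - 1) * ((Fintype.card F : ℝ)⁻¹ ^ r *
        (Fintype.card K : ℝ) ^ (r * (r + 1) / 2) *
        ∏ j ∈ range r, ((Fintype.card F : ℝ) - (Fintype.card K : ℝ) ^ j)) := by
  classical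
  have hX : (Fintype.card F : ℝ) ≠ 0 := by exact_mod_cast Fintype.card_ne_zero
  have hι : k - 1 = Fintype.card ι := by have := hJ.card_add_one; omega
  have hcount : ∀ x : Fin r → F, LinearIndependent K x →
      (#{b : ι → F | ∀ i, polarOp J b (x i) = 0} : ℝ) =
        (Fintype.card F : ℝ) ^ (k - 1) * ((Fintype.card F : ℝ)⁻¹ ^ r *
        (Fintype.card K : ℝ) ^ (r * (r + 1) / 2)) := by
    intro x hx
    have h := card_polarOp_eq_zero_mul (J := J) hψ hinv x
    rw [card_isDualTuple hJ hr hx] at h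
    have h' : (#{b : ι → F | ∀ i, polarOp J b (x i) = 0} : ℝ) * (Fintype.card F : ℝ) ^ r =
      (Fintype.card F : ℝ) ^ Fintype.card ι * (Fintype.card K : ℝ) ^ (r * (r + 1) / 2) := by
      exact_mod_cast h
    rw [hι, inv_pow]
    field_simp
    linear_combination h'
  have hF : (Fintype.card F : ℝ) = (Fintype.card K : ℝ) ^ finrank K F := by
    exact_mod_cast Module.card_eq_pow_finrank (K := K) (V := F)
  have hprod : ∏ j ∈ range r, ((Fintype.card F : ℝ) - (Fintype.card K : ℝ) ^ j) =
      #{x : Fin r → F | LinearIndependent K x} := by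
    rw [hF, ← natCard_linearIndependent_eq_prod, Nat.card_eq_fintype_card, Fintype.card_subtype]
  calc _ = ∑ b : ι → F, (#{x : Fin r → F | LinearIndependent K x ∧
          ∀ i, x i ∈ LinearMap.ker (polarOp J b)} : ℝ) := by
        refine sum_congr rfl fun b _ => ?_
        rw [← natCard_linearIndependent_eq_prod, natCard_linearIndependent_submodule]
    _ = ∑ b : ι → F, ∑ x : Fin r → F with LinearIndependent K x,
          (if ∀ i, polarOp J b (x i) = 0 then (1 : ℝ) else 0) := by
        refine sum_congr rfl fun b _ => ?_
        rw [← filter_filter, sum_boole]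
        simp only [LinearMap.mem_ker]
    _ = ∑ x : Fin r → F with LinearIndependent K x,
          (#{b : ι → F | ∀ i, polarOp J b (x i) = 0} : ℝ) := by
        rw [sum_comm]
        refine sum_congr rfl fun x _ => ?_
        rw [sum_boole]
    _ = _ := by
        rw [sum_congr rfl fun x hx => hcount x (mem_filter.1 hx).2, sum_const, nsmul_eq_mul, hprod]
        ring

/-- The sum of `|F| / |ker|` over all polar operators of a Gold family. -/
lemma sum_card_div_card_ker [DecidableEq ι] [Fintype K] [CharP F 2] (hJ : IsGoldFamily ρ J k) {ψ : AddChar F ℤ}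
    (hψ : ψ.IsPrimitive) (hinv : ∀ (g : Gal(F/K)) x, ψ (g x) = ψ x) :
    ∑ b : ι → F, (Fintype.card F : ℝ) *
        ((Fintype.card K : ℝ) ^ finrank K (LinearMap.ker (polarOp J b)))⁻¹ =
      1 + ∑ u ∈ range (k - 1), (-1) ^ u * ((Fintype.card K : ℝ) ^ ((u + 1) ^ 2))⁻¹ *
        ((Fintype.card F : ℝ) ^ (k - u) - Fintype.card F) *
        ∏ j ∈ range u, ((Fintype.card F : ℝ) - (Fintype.card K : ℝ) ^ (2 * j + 1)) := by
  classical
  have hX : (Fintype.card F : ℝ) ≠ 0 := by exact_mod_cast Fintype.card_ne_zero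
  have hq : (Fintype.card K : ℝ) ≠ 0 := by exact_mod_cast Fintype.card_ne_zero
  have hF : (Fintype.card F : ℝ) = (Fintype.card K : ℝ) ^ finrank K F := by
    exact_mod_cast Module.card_eq_pow_finrank (K := K) (V := F)
  have hk := hJ.card_add_one
  set R : (ι → F) → ℝ := fun b => (Fintype.card K : ℝ) ^ finrank K (LinearMap.ker (polarOp J b))
    with hR
  have hR0 : R 0 = Fintype.card F := by
    have : polarOp J (0 : ι → F) = 0 := by
      ext x; simp [polarOp_apply]
    simp only [hR]
    rw [this, LinearMap.ker_zero, finrank_top, hF]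
  have hmom := fun u (hu : u < k) => sum_prod_odd_of_moments univ R
    ((Fintype.card F : ℝ) ^ (k - 1)) hq hX (fun r hr => sum_prod_sub_pow hJ hψ hinv hr) hu
  have hinvR : ∀ b ∈ univ.erase (0 : ι → F), (R b)⁻¹ = ∑ u ∈ range (k - 1), (-1) ^ u *
      ((Fintype.card K : ℝ) ^ ((u + 1) ^ 2))⁻¹ *
        ∏ j ∈ range u, (R b - (Fintype.card K : ℝ) ^ (2 * j + 1)) := by
    intro b hb
    obtain ⟨s, hs, hfin⟩ := exists_finrank_ker_polarOp hJ (ne_of_mem_erase hb)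
    rw [inv_eq_sum_prod_odd hq (pow_ne_zero _ hq : R b ≠ 0) (k - 1)]
    -- The remainder vanishes because `R b` is one of `q, q^3, …, q^(2k-3)`.
    have : ∏ j ∈ range (k - 1), (R b - (Fintype.card K : ℝ) ^ (2 * j + 1)) = 0 :=
      prod_eq_zero (mem_range.2 hs) (by simp only [hR]; rw [hfin, sub_self])
    rw [this, mul_zero, zero_mul, add_zero]
  rw [← add_sum_erase _ _ (mem_univ (0 : ι → F))]
  change (Fintype.card F : ℝ) * (R 0)⁻¹ + ∑ b ∈ univ.erase 0, (Fintype.card F : ℝ) * (R b)⁻¹ = _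
  rw [hR0, mul_inv_cancel₀ hX, sum_congr rfl fun b hb => by rw [hinvR b hb], ← mul_sum, sum_comm,
    mul_sum]
  congr 1
  refine sum_congr rfl fun u hu => ?_
  have hu' := mem_range.1 hu
  have h1 := hmom u (by omega)
  -- The moment includes `b = 0`, where `R = X`; removing that term produces the `- X` in `X^(k-u) -
  -- X`.
  rw [← add_sum_erase _ _ (mem_univ (0 : ι → F)), hR0] at h1
  rw [← mul_sum]
  have h2 : (Fintype.card F : ℝ) ^ (k - u) =
      (Fintype.card F : ℝ) * ((Fintype.card F : ℝ) ^ (k - 1) * (Fintype.card F : ℝ)⁻¹ ^ u) := by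
    rw [show k - 1 = (k - u - 1) + u by omega, pow_add, mul_assoc, ← mul_pow,
      mul_inv_cancel₀ hX, one_pow, mul_one, ← pow_succ', show k - u - 1 + 1 = k - u by omega]
  rw [h2]
  linear_combination ((-1) ^ u * ((Fintype.card K : ℝ) ^ ((u + 1) ^ 2))⁻¹ *
    (Fintype.card F : ℝ)) * h1

end Moments

end GoldType

/-! ### Exponential sums of the quadratic phases. -/

namespace GoldType

open Finset Module

section ExpSum

variable {K F ι : Type*} [Field K] [Field F] [Fintype F] [Algebra K F] [Fintype ι]

/-- The function `x ↦ b₀ * x + ∑ j, b j * x * J j x`. -/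
def phase (J : ι → Gal(F/K)) (b₀ : F) (b : ι → F) (x : F) : F :=
  b₀ * x + ∑ j, b j * (x * J j x)

/-- The exponential sum of `phase`. -/
def expSum (ψ : AddChar F ℤ) (J : ι → Gal(F/K)) (b₀ : F) (b : ι → F) : ℤ :=
  ∑ x, ψ (phase J b₀ b x)

variable {ψ : AddChar F ℤ} {J : ι → Gal(F/K)}

lemma addChar_mul_self {F : Type*} [Field F] [CharP F 2] (ψ : AddChar F ℤ) (x : F) : ψ x * ψ x = 1 := by
  rw [← AddChar.map_add_eq_mul, CharTwo.add_self_eq_zero, AddChar.map_zero_eq_one]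

lemma addChar_phase_add (hinv : ∀ (g : Gal(F/K)) x, ψ (g x) = ψ x) (b₀ : F) (b : ι → F)
    (x y : F) :
    ψ (phase J b₀ b (x + y)) =
      ψ (phase J b₀ b x) * ψ (phase J b₀ b y) * ψ (x * polarOp J b y) := by
  rw [addChar_polarOp hinv, ← AddChar.map_add_eq_mul, ← AddChar.map_add_eq_mul]
  congr 1
  simp only [phase, map_add]
  have : ∑ j, b j * ((x + y) * (J j x + J j y)) = ∑ j, b j * (x * J j x) +
      ∑ j, b j * (y * J j y) + ∑ j, b j * (J j y * x + y * J j x) := by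
    rw [← sum_add_distrib, ← sum_add_distrib]
    exact sum_congr rfl fun j _ => by ring
  rw [this]
  ring

open Classical in
lemma expSum_mul_self [CharP F 2] (hψ : ψ.IsPrimitive)
    (hinv : ∀ (g : Gal(F/K)) x, ψ (g x) = ψ x) (b₀ : F) (b : ι → F) :
    expSum ψ J b₀ b * expSum ψ J b₀ b =
      Fintype.card F * ∑ y : LinearMap.ker (polarOp J b), ψ (phase J b₀ b y) := by
  have h1 : ∀ x, ∑ y, ψ (phase J b₀ b y) = ∑ y, ψ (phase J b₀ b (x + y)) := fun x =>
    (Fintype.sum_equiv (Equiv.addLeft x) _ _ fun y => rfl).symm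
  calc _ = ∑ x, ψ (phase J b₀ b x) * ∑ y, ψ (phase J b₀ b (x + y)) := by
        rw [expSum, sum_mul]
        exact sum_congr rfl fun x _ => by rw [← h1 x]
    _ = ∑ x, ∑ y, ψ (phase J b₀ b y) * ψ (x * polarOp J b y) := by
        refine sum_congr rfl fun x _ => ?_
        rw [mul_sum]
        refine sum_congr rfl fun y _ => ?_
        rw [addChar_phase_add hinv, ← mul_assoc, ← mul_assoc, addChar_mul_self, one_mul]
    _ = ∑ y, ψ (phase J b₀ b y) * (if polarOp J b y = 0 then (Fintype.card F : ℤ) else 0) := by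
        rw [sum_comm]
        refine sum_congr rfl fun y _ => ?_
        rw [← mul_sum, AddChar.sum_mulShift _ hψ]
        simp
    _ = ∑ y with y ∈ LinearMap.ker (polarOp J b), ψ (phase J b₀ b y) * Fintype.card F := by
        rw [sum_filter]
        refine sum_congr rfl fun y _ => ?_
        simp only [LinearMap.mem_ker, mul_ite, mul_zero]
    _ = _ := by
        rw [← sum_mul, mul_comm, sum_subtype (p := (· ∈ LinearMap.ker (polarOp J b))) _ (by simp)]

/-- On the kernel of the polar operator `ψ ∘ phase` is a character, so its sum there is either `0`
or the kernel size. -/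
lemma expSum_mul_self_eq_or [CharP F 2] (hψ : ψ.IsPrimitive)
    (hinv : ∀ (g : Gal(F/K)) x, ψ (g x) = ψ x) (b₀ : F) (b : ι → F) :
    expSum ψ J b₀ b * expSum ψ J b₀ b = if expSum ψ J b₀ b = 0 then 0 else
      (Fintype.card F : ℤ) * Nat.card (LinearMap.ker (polarOp J b)) := by
  classical
  split_ifs with h
  · rw [h, mul_zero]
  · have h2 := expSum_mul_self (J := J) hψ hinv b₀ b
    let χ : AddChar (LinearMap.ker (polarOp J b)) ℤ :=
      { toFun := fun y => ψ (phase J b₀ b y)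
        map_zero_eq_one' := by simp [phase]
        map_add_eq_mul' := fun x y => by
          rw [Submodule.coe_add, addChar_phase_add hinv, LinearMap.mem_ker.1 y.2, mul_zero,
            AddChar.map_zero_eq_one, mul_one] }
    have h3 : ∑ y : LinearMap.ker (polarOp J b), ψ (phase J b₀ b y) = ∑ y, χ y := rfl
    rw [h3, AddChar.sum_eq_ite] at h2
    rw [h2]
    split_ifs at h2 ⊢ with h4
    · rw [Nat.card_eq_fintype_card]
    · exact absurd (mul_self_eq_zero.1 (h2.trans (mul_zero _))) h

-- The second moment over `b₀` is evaluated twice: each nonzero sum contributes `X |ker|`, and by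
-- orthogonality in `b₀` only the zero vector of the kernel survives, giving `X²`.
open Classical in
lemma card_expSum_ne_zero_mul [CharP F 2] (hψ : ψ.IsPrimitive)
    (hinv : ∀ (g : Gal(F/K)) x, ψ (g x) = ψ x) (b : ι → F) :
    #{b₀ : F | expSum ψ J b₀ b ≠ 0} * Nat.card (LinearMap.ker (polarOp J b)) =
      Fintype.card F := by
  have hX : (Fintype.card F : ℤ) ≠ 0 := by exact_mod_cast Fintype.card_ne_zero
  have h1 : ∑ b₀, expSum ψ J b₀ b * expSum ψ J b₀ b =
      #{b₀ : F | expSum ψ J b₀ b ≠ 0} *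
        ((Fintype.card F : ℤ) * Nat.card (LinearMap.ker (polarOp J b))) := by
    simp_rw [expSum_mul_self_eq_or hψ hinv]
    rw [card_filter, Nat.cast_sum, sum_mul]
    exact sum_congr rfl fun b₀ _ => by split_ifs <;> simp_all
  have h2 : ∑ b₀, expSum ψ J b₀ b * expSum ψ J b₀ b = (Fintype.card F : ℤ) * Fintype.card F := by
    simp_rw [expSum_mul_self hψ hinv]
    rw [← mul_sum, sum_comm]
    congr 1
    have : ∀ y : LinearMap.ker (polarOp J b), ∑ b₀, ψ (phase J b₀ b y) =
        if y = 0 then (Fintype.card F : ℤ) else 0 := by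
      intro y
      simp only [phase, AddChar.map_add_eq_mul]
      rw [← sum_mul, AddChar.sum_mulShift _ hψ]
      by_cases hy : y = 0
      · simp [hy]
      · simp [hy]
    simp [this]
  rw [h1] at h2
  have h3 : (Fintype.card F : ℤ) * (#{b₀ : F | expSum ψ J b₀ b ≠ 0} *
      Nat.card (LinearMap.ker (polarOp J b))) = (Fintype.card F : ℤ) * Fintype.card F := by
    rw [← h2]; ring
  exact_mod_cast mul_left_cancel₀ hX h3

variable [Fintype K] {ρ : Gal(F/K)} {k : ℕ}

open Classical in
/-- The number of coefficient vectors whose exponential sum vanishes. -/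
lemma card_expSum_eq_zero [DecidableEq ι] [CharP F 2] (hJ : IsGoldFamily ρ J k) (hψ : ψ.IsPrimitive)
    (hinv : ∀ (g : Gal(F/K)) x, ψ (g x) = ψ x) :
    (#{p : F × (ι → F) | expSum ψ J p.1 p.2 = 0} : ℝ) = (Fintype.card F : ℝ) ^ k - 1 -
      ∑ u ∈ range (k - 1), (-1) ^ u * ((Fintype.card K : ℝ) ^ ((u + 1) ^ 2))⁻¹ *
        ((Fintype.card F : ℝ) ^ (k - u) - Fintype.card F) *
        ∏ j ∈ range u, ((Fintype.card F : ℝ) - (Fintype.card K : ℝ) ^ (2 * j + 1)) := by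
  have hk := hJ.card_add_one
  have h1 : (#{p : F × (ι → F) | expSum ψ J p.1 p.2 = 0} : ℝ) +
      #{p : F × (ι → F) | expSum ψ J p.1 p.2 ≠ 0} = (Fintype.card F : ℝ) ^ k := by
    have := card_filter_add_card_filter_not (s := (univ : Finset (F × (ι → F))))
      (fun p => expSum ψ J p.1 p.2 = 0)
    rw [card_univ, Fintype.card_prod, Fintype.card_fun, ← pow_succ', hk] at this
    exact_mod_cast this
  have h2 : (#{p : F × (ι → F) | expSum ψ J p.1 p.2 ≠ 0} : ℝ) = ∑ b : ι → F,
      (Fintype.card F : ℝ) *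
        ((Fintype.card K : ℝ) ^ finrank K (LinearMap.ker (polarOp J b)))⁻¹ := by
    rw [← sum_boole, Fintype.sum_prod_type_right]
    refine sum_congr rfl fun b _ => ?_
    rw [sum_boole]
    have h3 := card_expSum_ne_zero_mul (J := J) hψ hinv b
    rw [Module.natCard_eq_pow_finrank (K := K), Nat.card_eq_fintype_card] at h3
    have hq : (Fintype.card K : ℝ) ≠ 0 := by exact_mod_cast Fintype.card_ne_zero
    rw [eq_mul_inv_iff_mul_eq₀ (pow_ne_zero _ hq)]
    exact_mod_cast h3
  rw [h2, sum_card_div_card_ker hJ hψ hinv] at h1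
  linear_combination h1

/-- The coefficients are determined by the function `ψ ∘ phase`. -/
lemma addChar_phase_injective [CharP F 2] (hJ : IsGoldFamily ρ J k) (hψ : ψ.IsPrimitive)
    (hinv : ∀ (g : Gal(F/K)) x, ψ (g x) = ψ x) {b₀ : F} {b : ι → F}
    (h : ∀ x, ψ (phase J b₀ b x) = 1) : b₀ = 0 ∧ b = 0 := by
  classical
  have hb : b = 0 := by
    by_contra hne
    have hker : LinearMap.ker (polarOp J b) = ⊤ := by
      rw [eq_top_iff]
      intro y _
      rw [LinearMap.mem_ker]
      by_contra hy
      have h1 : ∀ x, ψ (x * polarOp J b y) = 1 := by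
        intro x
        have := addChar_phase_add (J := J) hinv b₀ b x y
        rwa [h, h, h, one_mul, one_mul, eq_comm] at this
      have h2 := AddChar.sum_mulShift (polarOp J b y) hψ
      simp [h1, hy] at h2
    have h3 := finrank_ker_polarOp_le hJ hne
    have h4 := hJ.two_mul_le
    have h5 := hJ.card_add_one
    rw [hker, finrank_top] at h3
    omega
  refine ⟨?_, hb⟩
  by_contra hb₀
  have h2 := AddChar.sum_mulShift b₀ hψ
  have h1 : ∀ x, ψ (x * b₀) = 1 := by
    intro x
    have := h x
    simpa [phase, hb, mul_comm] using this
  simp [h1, hb₀] at h2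

end ExpSum

end GoldType

/-! ### The three systems of decimation factors as Gold families. -/

namespace GoldType

open Finset Module

section Systems

variable {K F : Type*} [Field K] [Field F] [Algebra K F] {k : ℕ}

lemma IsGoldFamily.inv {ι : Type*} [Fintype ι] {ρ : Gal(F/K)} {J : ι → Gal(F/K)}
    (hJ : IsGoldFamily ρ J k) : IsGoldFamily ρ (fun i => (J i)⁻¹) k where
  gen := hJ.gen
  card_add_one := hJ.card_add_one
  two_mul_le := hJ.two_mul_le
  odd_finrank := hJ.odd_finrank
  inj := fun i j h => hJ.inj (inv_injective h)
  ne_inv := fun i j h => hJ.ne_inv j i (by simpa using h.symm)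
  window := by
    obtain ⟨w, hw⟩ := hJ.window
    exact ⟨w, fun i => ⟨(hw i).2, by simpa using (hw i).1⟩⟩
  cowindow := by
    obtain ⟨w, hw⟩ := hJ.cowindow
    refine ⟨w, fun g h1 h2 h3 => hw g h1 (fun i h => h3 i (by rw [h])) fun i h => h2 i ?_⟩
    rw [← h, inv_inv]

variable [Fintype F]

lemma exists_pow_lt_orderOf {ρ : Gal(F/K)} (gen : ∀ g, g ∈ Subgroup.zpowers ρ) (g : Gal(F/K)) :
    ∃ c < finrank K F, g = ρ ^ c := by
  have hpos : 0 < orderOf ρ := orderOf_pos ρ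
  obtain ⟨c, hc⟩ := (Submonoid.mem_powers_iff g ρ).1 (mem_powers_iff_mem_zpowers.2 (gen g))
  refine ⟨c % orderOf ρ, ?_, by rw [pow_mod_orderOf, hc]⟩
  rw [← orderOf_eq_finrank_of_gen gen]
  exact Nat.mod_lt _ hpos

lemma pow_eq_zpow_of_finrank {ρ : Gal(F/K)} (gen : ∀ g, g ∈ Subgroup.zpowers ρ) (a : ℕ) (z : ℤ)
    (h : (a : ℤ) = z ∨ (a : ℤ) = z + finrank K F) : ρ ^ a = ρ ^ z := by
  rcases h with h | h
  · rw [← h, zpow_natCast]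
  · rw [← zpow_natCast, h, zpow_add, zpow_natCast, ← orderOf_eq_finrank_of_gen gen,
      pow_orderOf_eq_one, mul_one]

lemma inv_pow_eq_of_add_eq_finrank {ρ : Gal(F/K)} (gen : ∀ g, g ∈ Subgroup.zpowers ρ) {a b : ℕ}
    (h : a + b = finrank K F) : (ρ ^ a)⁻¹ = ρ ^ b := by
  rw [inv_eq_iff_mul_eq_one, ← pow_add, h, ← orderOf_eq_finrank_of_gen gen, pow_orderOf_eq_one]

lemma isGoldFamily_consecutive {ρ : Gal(F/K)} (gen : ∀ g, g ∈ Subgroup.zpowers ρ) (hk : 1 ≤ k)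
    (hn : 2 * k ≤ finrank K F + 1) (hodd : Odd (finrank K F)) :
    IsGoldFamily ρ (fun i : Fin (k - 1) => ρ ^ (i.1 + 1)) k where
  gen := gen
  card_add_one := by rw [Fintype.card_fin]; omega
  two_mul_le := hn
  odd_finrank := hodd
  inj := by
    intro i j h
    have := pow_injOn_Iio_orderOf (x := ρ) (by
      rw [orderOf_eq_finrank_of_gen gen, Set.mem_Iio]; omega) (by
      rw [orderOf_eq_finrank_of_gen gen, Set.mem_Iio]; omega) h
    exact Fin.ext (by omega)
  ne_inv := by
    intro i j h
    rw [eq_inv_iff_mul_eq_one, ← pow_add] at h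
    exact pow_ne_one_of_lt_orderOf (by omega) (by
      rw [orderOf_eq_finrank_of_gen gen]; omega) h
  window := by
    refine ⟨-((k - 1 : ℕ) : ℤ), fun i => ⟨⟨i.1 + 1 + (k - 1), by omega, ?_⟩,
      ⟨k - 1 - (i.1 + 1), by omega, ?_⟩⟩⟩
    · exact pow_eq_zpow_of_finrank gen _ _ (Or.inl (by omega))
    · rw [inv_pow_eq_of_add_eq_finrank gen (b := finrank K F - (i.1 + 1)) (by omega)]
      exact pow_eq_zpow_of_finrank gen _ _ (Or.inr (by omega))
  cowindow := by
    refine ⟨k, fun g h1 h2 h3 => ?_⟩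
    obtain ⟨c, hc, rfl⟩ := exists_pow_lt_orderOf gen g
    have hc0 : c ≠ 0 := by rintro rfl; exact h1 (pow_zero ρ)
    have hc1 : k ≤ c := by
      by_contra h
      exact h2 ⟨c - 1, by omega⟩ (by congr 1; simp only; omega)
    have hc2 : k ≤ finrank K F - c := by
      by_contra h
      refine h3 ⟨finrank K F - c - 1, by omega⟩ ?_
      exact inv_pow_eq_of_add_eq_finrank gen (by simp only; omega)
    exact ⟨c - k, by omega, pow_eq_zpow_of_finrank gen _ _ (Or.inl (by omega))⟩

/-- The exponents and their negatives modulo `2t + 1` form the block from `t - k + 2` to `t + k -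
1`. The remaining residues run from `-(t + 1 - k)` to `t + 1 - k`, which is exactly the permitted
co-window. -/
lemma isGoldFamily_central {ρ : Gal(F/K)} (gen : ∀ g, g ∈ Subgroup.zpowers ρ) (hk : 1 ≤ k)
    {t : ℕ} (ht : finrank K F = 2 * t + 1) (hn : k ≤ t + 1) :
    IsGoldFamily ρ (fun i : Fin (k - 1) => ρ ^ (t - i.1)) k where
  gen := gen
  card_add_one := by rw [Fintype.card_fin]; omega
  two_mul_le := by omega
  odd_finrank := ⟨t, ht⟩
  inj := by
    intro i j h
    have := pow_injOn_Iio_orderOf (x := ρ) (by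
      rw [orderOf_eq_finrank_of_gen gen, Set.mem_Iio]; omega) (by
      rw [orderOf_eq_finrank_of_gen gen, Set.mem_Iio]; omega) h
    exact Fin.ext (by omega)
  ne_inv := by
    intro i j h
    rw [eq_inv_iff_mul_eq_one, ← pow_add] at h
    exact pow_ne_one_of_lt_orderOf (by omega) (by
      rw [orderOf_eq_finrank_of_gen gen]; omega) h
  window := by
    refine ⟨(t : ℤ) - k + 2, fun i => ⟨⟨k - 2 - i.1, by omega, ?_⟩,
      ⟨i.1 + k - 1, by omega, ?_⟩⟩⟩
    · exact pow_eq_zpow_of_finrank gen _ _ (Or.inl (by omega))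
    · rw [inv_pow_eq_of_add_eq_finrank gen (b := t + 1 + i.1) (by omega)]
      exact pow_eq_zpow_of_finrank gen _ _ (Or.inl (by omega))
  cowindow := by
    refine ⟨-((t + 1 - k : ℕ) : ℤ), fun g h1 h2 h3 => ?_⟩
    obtain ⟨c, hc, rfl⟩ := exists_pow_lt_orderOf gen g
    have hc1 : ¬ (t + 2 - k ≤ c ∧ c ≤ t) := by
      rintro ⟨h, h'⟩
      rcases Nat.lt_or_ge (t - c) (k - 1) with h4 | h4
      · exact h2 ⟨t - c, h4⟩ (by congr 1; simp only; omega)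
      · omega
    have hc2 : ¬ (t + 1 ≤ c ∧ c ≤ t + k - 1) := by
      rintro ⟨h, h'⟩
      rcases Nat.lt_or_ge (c - (t + 1)) (k - 1) with h4 | h4
      · exact h3 ⟨c - (t + 1), h4⟩ (inv_pow_eq_of_add_eq_finrank gen (by simp only; omega))
      · omega
    rcases Nat.lt_or_ge c (t + 2 - k) with h | h
    · exact ⟨c + (t + 1 - k), by omega, pow_eq_zpow_of_finrank gen _ _ (Or.inl (by omega))⟩
    · exact ⟨c + (t + 1 - k) - finrank K F, by omega,
        pow_eq_zpow_of_finrank gen _ _ (Or.inr (by omega))⟩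

/-- In odd degree and characteristic two, `x ↦ x * g x` is injective. -/
lemma mul_galois_injective [CharP F 2] (hodd : Odd (finrank K F)) (g : Gal(F/K)) :
    Function.Injective fun x : F => x * g x := by
  have hone : ∀ x : F, x * g x = 1 → x = 1 := by
    intro x hx
    have hx0 : x ≠ 0 := left_ne_zero_of_mul_eq_one hx
    have h1 : g x = x⁻¹ := eq_inv_of_mul_eq_one_right hx
    have h2 : (g ^ 2) x = x := by
      rw [pow_two, AlgEquiv.mul_apply, h1, map_inv₀, h1, inv_inv]
    obtain ⟨t, ht⟩ := hodd
    -- In a group of odd order `g` is a power of `g²`, so an element fixed by `g²` is fixed by `g`.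
    have h3 : (g ^ 2) ^ (t + 1) = g := by
      rw [← pow_mul, show 2 * (t + 1) = 2 * t + 1 + 1 by ring, ← ht, pow_succ,
        ← IsGalois.card_aut_eq_finrank K F, pow_card_eq_one', one_mul]
    have h4 : ∀ i : ℕ, ((g ^ 2) ^ i) x = x := by
      intro i
      induction i with
      | zero => rfl
      | succ i ih => rw [pow_succ, AlgEquiv.mul_apply, h2, ih]
    have h5 := h4 (t + 1)
    rw [h3] at h5
    rw [h5] at hx
    have h6 : (x + 1) * (x + 1) = 0 := by
      rw [CharTwo.add_mul_self, hx, one_mul, CharTwo.add_self_eq_zero]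
    exact CharTwo.add_eq_zero.1 (mul_self_eq_zero.1 h6)
  intro x y hxy
  simp only at hxy
  by_cases hy : y = 0
  · rw [hy, zero_mul, mul_eq_zero, map_eq_zero, or_self] at hxy
    rw [hxy, hy]
  · have hgy : g y ≠ 0 := (map_ne_zero g).2 hy
    have := hone (x / y) (by rw [map_div₀, div_mul_div_comm, hxy, div_self (mul_ne_zero hy hgy)])
    rwa [div_eq_one_iff_eq hy] at this

end Systems

lemma exists_fixedField {F : Type*} [Field F] [Fintype F] [Algebra (ZMod 2) F] {m : ℕ}
    (hm : 0 < m) (hF : Fintype.card F = 2 ^ m) (d : ℕ) :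
    ∃ (K : IntermediateField (ZMod 2) F) (ρ : Gal(F/K)), Nat.card K = 2 ^ Nat.gcd m d ∧
      finrank K F = m / Nat.gcd m d ∧ (∀ x, ρ x = x ^ 2 ^ d) ∧
      ∀ g, g ∈ Subgroup.zpowers ρ := by
  have hfin : finrank (ZMod 2) F = m := by
    have h := Module.card_eq_pow_finrank (K := ZMod 2) (V := F)
    rw [hF, ZMod.card] at h
    exact (Nat.pow_right_injective le_rfl h).symm
  set φ : Gal(F/ZMod 2) := FiniteField.frobeniusAlgEquivOfAlgebraic (ZMod 2) F with hφ
  set σ := φ ^ d with hσ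
  have hφord : orderOf φ = m := by
    rw [hφ, FiniteField.orderOf_frobeniusAlgEquivOfAlgebraic, hfin]
  have hφx : ∀ (i : ℕ) (x : F), (φ ^ i) x = x ^ 2 ^ i := by
    intro i x
    induction i generalizing x with
    | zero => simp
    | succ i ih =>
      have : φ x = x ^ 2 := by
        rw [hφ, FiniteField.coe_frobeniusAlgEquivOfAlgebraic, ZMod.card]
      rw [pow_succ, AlgEquiv.mul_apply, this, ih, ← pow_mul, ← pow_succ']
  have hσord : orderOf σ = m / Nat.gcd m d := by rw [hσ, orderOf_pow, hφord]
  set K : IntermediateField (ZMod 2) F := IntermediateField.fixedField (Subgroup.zpowers σ)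
    with hK
  have hKF : finrank K F = m / Nat.gcd m d := by
    rw [hK, IntermediateField.finrank_fixedField_eq_card, Nat.card_zpowers, hσord]
  have hcomm : ∀ c : K, σ (algebraMap K F c) = algebraMap K F c := by
    intro c
    exact (IntermediateField.mem_fixedField_iff _ _).1 c.2 σ (Subgroup.mem_zpowers σ)
  let ρ : Gal(F/K) := AlgEquiv.ofRingEquiv (f := σ.toRingEquiv) hcomm
  have hρx : ∀ x, ρ x = σ x := fun x => rfl
  have hρpow : ∀ (i : ℕ) x, (ρ ^ i) x = (σ ^ i) x := by
    intro i
    induction i with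
    | zero => intro x; rfl
    | succ i ih => intro x; rw [pow_succ, pow_succ, AlgEquiv.mul_apply, AlgEquiv.mul_apply, ih, hρx]
  have hρord : orderOf ρ = orderOf σ := by
    refine orderOf_eq_orderOf_iff.2 fun i => ?_
    constructor
    · intro h; ext x; rw [← hρpow, h]; rfl
    · intro h; ext x; rw [hρpow, h]; rfl
  refine ⟨K, ρ, ?_, hKF, fun x => by rw [hρx, hσ, hφx], fun g => ?_⟩
  · have h1 := finrank_mul_finrank (ZMod 2) K F
    rw [Module.natCard_eq_pow_finrank (K := ZMod 2), Nat.card_zmod]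
    congr 1
    rw [hfin, hKF] at h1
    have hg : 0 < Nat.gcd m d := Nat.gcd_pos_of_pos_left _ hm
    have h2 := Nat.mul_div_cancel' (Nat.gcd_dvd_left m d)
    have h3 : 0 < m / Nat.gcd m d := Nat.div_pos (Nat.gcd_le_left _ hm) hg
    exact Nat.eq_of_mul_eq_mul_right h3 (h1.trans h2.symm)
  · have : Subgroup.zpowers ρ = ⊤ := by
      apply Subgroup.eq_top_of_card_eq
      rw [Nat.card_zpowers, hρord, hσord, IsGalois.card_aut_eq_finrank, hKF]
    rw [this]; trivial

/-- The equality of the two gcds forces `m / e` to be odd: otherwise `2e` would divide both `m` and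
`2d`, hence `e`. -/
lemma Parameters.exists_odd {m d e k : ℕ} (h : Parameters m d e k) :
    ∃ t, m = e * (2 * t + 1) ∧ k ≤ t + 1 ∧ 0 < e ∧ e ∣ d := by
  have he : 0 < e := by rw [h.gcd_eq]; exact Nat.gcd_pos_of_pos_left _ h.m_pos
  have hed : e ∣ d := by rw [h.gcd_eq]; exact Nat.gcd_dvd_right m d
  obtain ⟨n, hn⟩ : e ∣ m := by rw [h.gcd_eq]; exact Nat.gcd_dvd_left m d
  rcases Nat.even_or_odd n with ⟨t, ht⟩ | ⟨t, ht⟩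
  · have h2 : 2 * e ∣ e := by
      nth_rw 2 [h.gcd_two_eq]
      exact Nat.dvd_gcd ⟨t, by rw [hn, ht]; ring⟩ (Nat.mul_dvd_mul_left 2 hed)
    have := Nat.le_of_dvd he h2
    omega
  · refine ⟨t, by rw [hn, ht], ?_, he, hed⟩
    have h1 := h.le_bound
    rw [hn, ht, show e * (2 * t + 1) + e = 2 * e * (t + 1) by ring] at h1
    exact Nat.le_of_mul_le_mul_left h1 (by omega)

lemma pow_two_pow_add_mul {F : Type*} [Field F] [Fintype F] {m : ℕ}
    (hF : Fintype.card F = 2 ^ m) (x : F) (a c : ℕ) : x ^ 2 ^ (a + m * c) = x ^ 2 ^ a := by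
  induction c with
  | zero => rfl
  | succ c ih => rw [mul_add, ← add_assoc, mul_one, pow_add, pow_mul, ih, ← hF, FiniteField.pow_card]

/-- Each of the three systems of decimation factors comes from a Gold family. -/
lemma exists_goldFamily {F : Type*} [Field F] [Fintype F] [Algebra (ZMod 2) F] {m d e k : ℕ}
    (h : Parameters m d e k) (hF : Fintype.card F = 2 ^ m) (S : System) :
    ∃ (K : IntermediateField (ZMod 2) F) (ρ : Gal(F/K)) (J : Fin (k - 1) → Gal(F/K)),
      Nat.card K = 2 ^ e ∧ IsGoldFamily ρ J k ∧
      ∀ i x, x * J i x = x ^ S.factor m d e (i.1 + 1) := by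
  obtain ⟨t, hm, hkt, he, hed⟩ := h.exists_odd
  have hk1 : 1 ≤ k := le_trans (by norm_num) h.two_le
  have hn : m / e = 2 * t + 1 := by rw [hm, Nat.mul_div_cancel_left _ he]
  have hpow : ∀ {K : IntermediateField (ZMod 2) F} {ρ : Gal(F/K)} {d : ℕ},
      (∀ x, ρ x = x ^ 2 ^ d) → ∀ (i : ℕ) x, (ρ ^ i) x = x ^ 2 ^ (i * d) := by
    intro K ρ d hρ i
    induction i with
    | zero => intro x; simp
    | succ i ih =>
      intro x
      rw [pow_succ, AlgEquiv.mul_apply, hρ, ih, ← pow_mul, ← pow_add, add_mul, one_mul, add_comm]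
  cases S with
  | consecutive =>
    obtain ⟨K, ρ, hKc, hKF, hρ, gen⟩ := exists_fixedField h.m_pos hF d
    rw [← h.gcd_eq] at hKc hKF
    rw [hn] at hKF
    refine ⟨K, ρ, _, hKc, isGoldFamily_consecutive gen hk1 (by omega) ⟨t, hKF⟩, fun i x => ?_⟩
    rw [hpow hρ, System.factor, pow_succ']
  | odd =>
    obtain ⟨K, ρ, hKc, hKF, hρ, gen⟩ := exists_fixedField h.m_pos hF (2 * d)
    rw [← h.gcd_two_eq] at hKc hKF
    rw [hn] at hKF
    -- With `ρ = Frob^(2d)`, the inverse of `ρ^(t-i)` is `ρ^(t+1+i)`. Its Frobenius exponent is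
    -- `2(t+1+i)d = (2i+1)d + (2t+1)d`, and `(2t+1)d` is a multiple of `m` because `e ∣ d`.
    refine ⟨K, ρ, _, hKc, (isGoldFamily_central gen hk1 hKF hkt).inv, fun i x => ?_⟩
    rw [inv_pow_eq_of_add_eq_finrank gen (b := t + 1 + i.1) (by omega), hpow hρ, System.factor,
      pow_succ']
    obtain ⟨c, rfl⟩ := hed
    rw [← pow_two_pow_add_mul hF x ((2 * (i.1 + 1) - 1) * (e * c)) c, hm]
    congr 3
    rw [show 2 * (i.1 + 1) - 1 = 2 * i.1 + 1 by omega]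
    ring
  | descending =>
    obtain ⟨K, ρ, hKc, hKF, hρ, gen⟩ := exists_fixedField h.m_pos hF d
    rw [← h.gcd_eq] at hKc hKF
    rw [hn] at hKF
    refine ⟨K, ρ, _, hKc, isGoldFamily_central gen hk1 hKF hkt, fun i x => ?_⟩
    have hq : (m + e) / (2 * e) = t + 1 := by
      rw [hm, show e * (2 * t + 1) + e = (2 * e) * (t + 1) by ring,
        Nat.mul_div_cancel_left _ (by omega)]
    rw [hpow hρ, System.factor, pow_succ', hq, show t + 1 - (i.1 + 1) = t - i.1 by omega]

end GoldType

/-! ### Maximum-length sequences as trace sequences. -/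

namespace GoldType

open Finset Module Polynomial

section Field

/-- The shift operator on binary sequences. -/
def shiftOp (m : ℕ) : BinSeq m →ₗ[ZMod 2] BinSeq m where
  toFun s := fun i => s (i + 1)
  map_add' _ _ := rfl
  map_smul' _ _ := rfl

lemma shiftOp_pow_apply {m : ℕ} (n : ℕ) (s : BinSeq m) (i : ZMod (2 ^ m - 1)) :
    (shiftOp m ^ n) s i = s (i + n) := by
  induction n generalizing i with
  | zero => simp
  | succ n ih =>
    rw [pow_succ', Module.End.mul_apply]
    change (shiftOp m ^ n) s (i + 1) = _
    rw [ih]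
    congr 1
    push_cast
    ring

/-- The polynomials annihilating a sequence under the shift operator. -/
def annIdeal {m : ℕ} (s : BinSeq m) : Ideal (ZMod 2)[X] where
  carrier := {f | aeval (shiftOp m) f s = 0}
  add_mem' := by
    intro f g hf hg
    simp only [Set.mem_ofPred_eq] at *
    rw [map_add, LinearMap.add_apply, hf, hg, add_zero]
  zero_mem' := by simp
  smul_mem' := by
    intro c f hf
    simp only [Set.mem_ofPred_eq] at *
    rw [smul_eq_mul, map_mul, Module.End.mul_apply, hf, map_zero]

lemma mem_annIdeal {m : ℕ} {s : BinSeq m} {f : (ZMod 2)[X]} :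
    f ∈ annIdeal s ↔ aeval (shiftOp m) f s = 0 := Iff.rfl

variable {m : ℕ} {s : BinSeq m}

lemma card_quotient_annIdeal_le (hm : 2 ≤ m) (hs : IsMaxLength m s) :
    Finite ((ZMod 2)[X] ⧸ annIdeal s) ∧ Nat.card ((ZMod 2)[X] ⧸ annIdeal s) ≤ 2 ^ m := by
  obtain ⟨⟨a, ha⟩, -⟩ := hs
  set r : (ZMod 2)[X] := ∑ j : Fin m, C (a j) * X ^ (j : ℕ) with hr
  have hrdeg : r.degree < m := by
    rw [hr]
    exact degree_sum_fin_lt a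
  have hmonic : (X ^ m - r).Monic := monic_X_pow_sub hrdeg
  have hdeg : (X ^ m - r).natDegree = m := by
    refine natDegree_eq_of_degree_eq_some ?_
    rw [degree_sub_eq_left_of_degree_lt (by rwa [degree_X_pow]), degree_X_pow]
  have hmem : X ^ m - r ∈ annIdeal s := by
    rw [mem_annIdeal]
    funext i
    simp only [hr, map_sub, map_pow, aeval_X, map_sum, map_mul, aeval_C, LinearMap.sub_apply,
      LinearMap.sum_apply, Pi.sub_apply, Finset.sum_apply, Pi.zero_apply, Module.End.mul_apply,
      Module.algebraMap_end_apply, Pi.smul_apply, smul_eq_mul, shiftOp_pow_apply]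
    rw [ha, sub_self]
  have hsurj : Function.Surjective (fun c : Fin m → ZMod 2 =>
      Ideal.Quotient.mk (annIdeal s) (∑ j : Fin m, C (c j) * X ^ (j : ℕ))) := by
    intro x
    obtain ⟨f, rfl⟩ := Ideal.Quotient.mk_surjective x
    refine ⟨fun j => (f %ₘ (X ^ m - r)).coeff j, ?_⟩
    have h1 : f %ₘ (X ^ m - r) = ∑ j : Fin m, C ((f %ₘ (X ^ m - r)).coeff j) * X ^ (j : ℕ) := by
      rw [Fin.sum_univ_eq_sum_range (fun j => C ((f %ₘ (X ^ m - r)).coeff j) * X ^ j)]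
      simp only [C_mul_X_pow_eq_monomial]
      refine as_sum_range' _ _ ?_
      conv_rhs => rw [← hdeg]
      refine natDegree_modByMonic_lt f hmonic fun h => ?_
      rw [h, natDegree_one] at hdeg
      omega
    simp only
    rw [← h1, Ideal.Quotient.mk_eq_mk_iff_sub_mem]
    have h2 := modByMonic_add_div f (X ^ m - r)
    have : f %ₘ (X ^ m - r) - f = (X ^ m - r) * (-(f /ₘ (X ^ m - r))) := by
      linear_combination h2
    rw [this]
    exact Ideal.mul_mem_right _ _ hmem
  refine ⟨Finite.of_surjective _ hsurj, (Nat.card_le_card_of_surjective _ hsurj).trans ?_⟩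
  simp

/-- The recurrence bounds the quotient by `2^m` elements, while the least period makes `0` and the
powers `X^i`, `i < 2^m - 1`, distinct. These are already `2^m` elements, so they exhaust the
quotient. -/
lemma quotient_annIdeal_eq_powers (hm : 2 ≤ m) (hs : IsMaxLength m s) :
    Nat.card ((ZMod 2)[X] ⧸ annIdeal s) = 2 ^ m ∧
    (∀ n : ℕ, Ideal.Quotient.mk (annIdeal s) X ^ n ≠ 0) ∧
    Ideal.Quotient.mk (annIdeal s) X ^ (2 ^ m - 1) = 1 ∧
    ∀ x : (ZMod 2)[X] ⧸ annIdeal s, x ≠ 0 →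
      ∃ i : ℕ, x = Ideal.Quotient.mk (annIdeal s) X ^ i := by
  obtain ⟨hfin, hcard⟩ := card_quotient_annIdeal_le hm hs
  have hN : 1 < 2 ^ m - 1 := by
    have := Nat.pow_le_pow_right (n := 2) (by norm_num) hm
    omega
  have : Fact (1 < 2 ^ m - 1) := ⟨hN⟩
  have : NeZero (2 ^ m - 1) := ⟨by omega⟩
  have hs0 : s ≠ 0 := by
    rintro rfl
    exact one_ne_zero (hs.2 1 fun i => rfl)
  let p : Option (ZMod (2 ^ m - 1)) → (ZMod 2)[X] ⧸ annIdeal s := fun o =>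
    o.elim 0 fun i => Ideal.Quotient.mk (annIdeal s) X ^ i.val
  have hpow : ∀ (n : ℕ), aeval (shiftOp m) (X ^ n : (ZMod 2)[X]) s = fun i => s (i + n) := by
    intro n
    funext i
    rw [map_pow, aeval_X, shiftOp_pow_apply]
  have hne : ∀ n : ℕ, Ideal.Quotient.mk (annIdeal s) X ^ n ≠ 0 := by
    intro n h
    rw [← map_pow, Ideal.Quotient.eq_zero_iff_mem, mem_annIdeal, hpow] at h
    refine hs0 ?_
    funext i
    have := congrFun h (i - n)
    simpa using this
  have hinj : Function.Injective p := by
    intro o o' h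
    rcases o with _ | i <;> rcases o' with _ | j
    · rfl
    · exact absurd h.symm (hne _)
    · exact absurd h (hne _)
    · change Ideal.Quotient.mk (annIdeal s) X ^ i.val = Ideal.Quotient.mk (annIdeal s) X ^ j.val at h
      rw [← map_pow, ← map_pow, Ideal.Quotient.mk_eq_mk_iff_sub_mem, mem_annIdeal, map_sub,
        LinearMap.sub_apply, hpow, hpow, sub_eq_zero] at h
      congr 1
      rw [← sub_eq_zero]
      refine hs.2 _ fun l => ?_
      have := congrFun h (l - j)
      simp only [ZMod.natCast_val, ZMod.cast_id', id_eq, sub_add_cancel] at this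
      rw [← this]
      congr 1
      ring
  have hopt : Nat.card (Option (ZMod (2 ^ m - 1))) = 2 ^ m := by
    rw [Nat.card_eq_fintype_card, Fintype.card_option, ZMod.card]
    omega
  have hbij : Function.Bijective p :=
    hinj.bijective_of_nat_card_le (hcard.trans hopt.symm.le)
  refine ⟨by rw [← hopt, Nat.card_eq_of_bijective p hbij], hne, ?_, fun x hx => ?_⟩
  · rw [← map_pow, ← map_one (Ideal.Quotient.mk (annIdeal s)),
      Ideal.Quotient.mk_eq_mk_iff_sub_mem, mem_annIdeal, map_sub, LinearMap.sub_apply, hpow,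
      map_one, Module.End.one_apply, sub_eq_zero]
    funext i
    rw [ZMod.natCast_self, add_zero]
  obtain ⟨o, ho⟩ := hbij.2 x
  rcases o with _ | i
  · exact absurd ho.symm hx
  · exact ⟨i.val, ho.symm⟩

/-- Applied to the functional `f ↦ (f s)(0)` on the quotient, whose value at `X^i` is `s i`. -/
lemma exists_trace_eq {F : Type*} [Field F] [Finite F] [Algebra (ZMod 2) F]
    (ℓ : F →+ ZMod 2) : ∃ β : F, ∀ x, ℓ x = Algebra.trace (ZMod 2) F (β * x) := by
  have hnd := traceForm_nondegenerate (ZMod 2) F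
  let ℓ' : F →ₗ[ZMod 2] ZMod 2 := ℓ.toZModLinearMap 2
  refine ⟨((Algebra.traceForm (ZMod 2) F).toDual hnd).symm ℓ', fun x => ?_⟩
  exact (LinearMap.BilinForm.apply_toDual_symm_apply (B := Algebra.traceForm (ZMod 2) F)
    (hB := hnd) (f := ℓ') x).symm

/-- A maximum-length sequence is a trace sequence `i ↦ Tr (β * α ^ i)` of a field with `2 ^ m`
elements, with `α` primitive. -/
lemma exists_field_of_isMaxLength (hm : 2 ≤ m) (hs : IsMaxLength m s) :
    ∃ (F : Type) (_ : Field F) (_ : Fintype F) (_ : Algebra (ZMod 2) F) (α β : F),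
      Fintype.card F = 2 ^ m ∧ β ≠ 0 ∧ α ≠ 0 ∧ (∀ x : F, x ≠ 0 → ∃ i : ℕ, x = α ^ i) ∧
      ∀ i : ℕ, s i = Algebra.trace (ZMod 2) F (β * α ^ i) := by
  obtain ⟨hfin, hcard⟩ := card_quotient_annIdeal_le hm hs
  obtain ⟨hcardeq, hne, hXN, hX⟩ := quotient_annIdeal_eq_powers hm hs
  have hunit : IsUnit (Ideal.Quotient.mk (annIdeal s) X) := by
    refine IsUnit.of_pow_eq_one hXN ?_
    have := Nat.pow_le_pow_right (n := 2) (by norm_num) hm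
    omega
  have hfield : IsField ((ZMod 2)[X] ⧸ annIdeal s) :=
    { exists_pair_ne := ⟨1, 0, by simpa using hne 0⟩
      mul_comm := mul_comm
      mul_inv_cancel := by
        intro x hx
        obtain ⟨i, rfl⟩ := hX x hx
        obtain ⟨y, hy⟩ := (hunit.pow i).exists_right_inv
        exact ⟨y, hy⟩ }
  have hmax : (annIdeal s).IsMaximal := Ideal.Quotient.maximal_of_isField _ hfield
  let : Field ((ZMod 2)[X] ⧸ annIdeal s) := Ideal.Quotient.field _
  let : Fintype ((ZMod 2)[X] ⧸ annIdeal s) := Fintype.ofFinite _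
  have hwd : ∀ f : (ZMod 2)[X], aeval (shiftOp m)
      (Quotient.out (Ideal.Quotient.mk (annIdeal s) f)) s = aeval (shiftOp m) f s := by
    intro f
    have h : Ideal.Quotient.mk (annIdeal s) (Quotient.out (Ideal.Quotient.mk (annIdeal s) f)) =
      Ideal.Quotient.mk (annIdeal s) f := Quotient.out_eq _
    rw [Ideal.Quotient.mk_eq_mk_iff_sub_mem, mem_annIdeal, map_sub, LinearMap.sub_apply,
      sub_eq_zero] at h
    exact h
  let ℓ : ((ZMod 2)[X] ⧸ annIdeal s) →+ ZMod 2 :=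
    { toFun := fun x => aeval (shiftOp m) (Quotient.out x) s 0
      map_zero' := by
        have := hwd 0
        rw [map_zero, map_zero] at this
        rw [this]; rfl
      map_add' := by
        intro x y
        obtain ⟨f, rfl⟩ := Ideal.Quotient.mk_surjective x
        obtain ⟨g, rfl⟩ := Ideal.Quotient.mk_surjective y
        rw [← map_add, hwd, hwd, hwd, map_add]; rfl }
  have hℓ : ∀ i : ℕ, ℓ (Ideal.Quotient.mk (annIdeal s) X ^ i) = s i := by
    intro i
    change aeval (shiftOp m) (Quotient.out (Ideal.Quotient.mk (annIdeal s) X ^ i)) s 0 = s i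
    rw [← map_pow, hwd, map_pow, aeval_X, shiftOp_pow_apply, zero_add]
  obtain ⟨β, hβ⟩ := exists_trace_eq ℓ
  refine ⟨(ZMod 2)[X] ⧸ annIdeal s, inferInstance, inferInstance, inferInstance,
    Ideal.Quotient.mk (annIdeal s) X, β, ?_, ?_, by simpa using hne 1, hX, fun i => ?_⟩
  · rw [← Nat.card_eq_fintype_card, hcardeq]
  · rintro rfl
    refine hne 0 ?_
    have hs0 : s = 0 := by
      have hN : NeZero (2 ^ m - 1) := ⟨by
        have := Nat.pow_le_pow_right (n := 2) (by norm_num) hm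
        omega⟩
      funext i
      have := hℓ i.val
      rw [hβ, zero_mul, map_zero, ZMod.natCast_val, ZMod.cast_id] at this
      exact this.symm
    rw [pow_zero, ← map_one (Ideal.Quotient.mk (annIdeal s)), Ideal.Quotient.eq_zero_iff_mem,
      mem_annIdeal, hs0, map_zero]
  · rw [← hℓ, hβ]

end Field

end GoldType

/-! ### The code as the image of an injective encoding. -/

namespace GoldType

open Finset Module

section Code

variable {F : Type*} [Field F] [Algebra (ZMod 2) F]

/-- The additive character `x ↦ (-1) ^ Tr x`. -/
noncomputable def traceChar (F : Type*) [Field F] [Algebra (ZMod 2) F] : AddChar F ℤ where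
  toFun x := (-1) ^ (Algebra.trace (ZMod 2) F x).val
  map_zero_eq_one' := by simp
  map_add_eq_mul' x y := by
    rw [map_add]
    generalize Algebra.trace (ZMod 2) F x = a
    generalize Algebra.trace (ZMod 2) F y = b
    revert a b
    decide

lemma traceChar_apply (x : F) : traceChar F x = (-1) ^ (Algebra.trace (ZMod 2) F x).val := rfl

lemma traceChar_eq_one_iff (x : F) : traceChar F x = 1 ↔ Algebra.trace (ZMod 2) F x = 0 := by
  rw [traceChar_apply]
  generalize Algebra.trace (ZMod 2) F x = a
  revert a
  decide

lemma traceChar_isPrimitive [Finite F] : (traceChar F).IsPrimitive := by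
  intro a ha h
  refine ha ((traceForm_nondegenerate (ZMod 2) F).1 a fun b => ?_)
  rw [Algebra.traceForm_apply, ← traceChar_eq_one_iff]
  have := DFunLike.congr_fun h b
  simpa [AddChar.mulShift_apply] using this

lemma traceChar_galois (K : IntermediateField (ZMod 2) F) (g : Gal(F/K)) (x : F) :
    traceChar F (g x) = traceChar F x := by
  rw [traceChar_apply, traceChar_apply]
  congr 2
  exact Algebra.trace_eq_of_algEquiv (g.restrictScalars (ZMod 2)) x

variable {K : IntermediateField (ZMod 2) F} {ι : Type*} [Fintype ι]

/-- The codeword `i ↦ Tr (b₀ α^i + ∑ j, b j * α^i * J j (α^i))`. -/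
noncomputable def encode (m : ℕ) (J : ι → Gal(F/K)) (α : F) :
    (F × (ι → F)) →ₗ[ZMod 2] BinSeq m where
  toFun p := fun i => Algebra.trace (ZMod 2) F (phase J p.1 p.2 (α ^ i.val))
  map_add' p p' := by
    funext i
    rw [Pi.add_apply, ← map_add]
    congr 1
    simp only [phase, Prod.fst_add, Prod.snd_add, Pi.add_apply, add_mul, sum_add_distrib]
    ring
  map_smul' c p := by
    funext i
    rw [Pi.smul_apply, RingHom.id_apply, ← map_smul]
    congr 1
    simp only [phase, Prod.smul_fst, Prod.smul_snd, Pi.smul_apply, smul_mul_assoc, smul_add,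
      smul_sum]

lemma encode_apply (m : ℕ) (J : ι → Gal(F/K)) (α : F) (p : F × (ι → F)) (i) :
    encode m J α p i = Algebra.trace (ZMod 2) F (phase J p.1 p.2 (α ^ i.val)) := rfl

variable [Fintype F] {m k : ℕ} {J : ι → Gal(F/K)} {α : F}

lemma dc_encode (hm : 2 ≤ m) (hF : Fintype.card F = 2 ^ m) (hα0 : α ≠ 0)
    (hα : ∀ x : F, x ≠ 0 → ∃ i : ℕ, x = α ^ i) (p : F × (ι → F)) :
    dc (encode m J α p) = expSum (traceChar F) J p.1 p.2 - 1 := by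
  classical
  have hN : 0 < 2 ^ m - 1 := by
    have := Nat.pow_le_pow_right (n := 2) (by norm_num) hm
    omega
  have hαN : α ^ (2 ^ m - 1) = 1 := by
    rw [← hF]; exact FiniteField.pow_card_sub_one_eq_one α hα0
  have himage : (range (2 ^ m - 1)).image (fun i => α ^ i) = univ.erase (0 : F) := by
    ext x
    simp only [mem_image, mem_range, mem_erase, mem_univ, and_true]
    constructor
    · rintro ⟨i, -, rfl⟩
      exact pow_ne_zero i hα0
    · intro hx
      obtain ⟨i, rfl⟩ := hα x hx
      exact ⟨i % (2 ^ m - 1), Nat.mod_lt _ hN, (pow_eq_pow_mod i hαN).symm⟩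
  have hinj : Set.InjOn (fun i : ℕ => α ^ i) (range (2 ^ m - 1)) := by
    rw [← card_image_iff, himage, card_erase_of_mem (mem_univ _), card_univ, card_range, hF]
  -- The powers of `α` run once through the nonzero elements; the missing term at `x = 0` equals `1`
  -- and accounts for the `- 1`.
  rw [expSum, ← add_sum_erase _ _ (mem_univ (0 : F)), ← himage, sum_image hinj]
  have h0 : traceChar F (phase J p.1 p.2 0) = 1 := by simp [phase]
  rw [h0, add_sub_cancel_left, dc]
  refine sum_congr rfl fun i hi => ?_
  rw [encode_apply, traceChar_apply, ZMod.val_natCast, ← pow_eq_pow_mod i hαN]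

lemma encode_injective [CharP F 2] [Fintype K] {ρ : Gal(F/K)} (hJ : IsGoldFamily ρ J k)
    (hF : Fintype.card F = 2 ^ m) (hα0 : α ≠ 0)
    (hα : ∀ x : F, x ≠ 0 → ∃ i : ℕ, x = α ^ i) :
    Function.Injective (encode m J α) := by
  have hαN : α ^ (2 ^ m - 1) = 1 := by
    rw [← hF]; exact FiniteField.pow_card_sub_one_eq_one α hα0
  rw [injective_iff_map_eq_zero]
  rintro ⟨b₀, b⟩ h
  have := addChar_phase_injective (b₀ := b₀) (b := b) hJ traceChar_isPrimitive
    (traceChar_galois K) (fun x => by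
      by_cases hx : x = 0
      · simp [hx, phase]
      · obtain ⟨i, rfl⟩ := hα x hx
        rw [traceChar_eq_one_iff]
        have := congrFun h i
        rwa [encode_apply, ZMod.val_natCast, ← pow_eq_pow_mod i hαN] at this)
  rw [this.1, this.2]; rfl

/-- Shifting by `t` multiplies a coefficient by a power of `α`, so the generators are codewords with
a single nonzero coefficient. -/
lemma code_eq_range_encode [CharP F 2] {d e : ℕ} {S : System} {s : BinSeq m} {β : F}
    {ρ : Gal(F/K)} {J : Fin (k - 1) → Gal(F/K)} (hJ : IsGoldFamily ρ J k)
    (hJf : ∀ i x, x * J i x = x ^ S.factor m d e (i.1 + 1))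
    (hm : 2 ≤ m) (hF : Fintype.card F = 2 ^ m) (hα0 : α ≠ 0) (hβ : β ≠ 0)
    (hα : ∀ x : F, x ≠ 0 → ∃ i : ℕ, x = α ^ i)
    (hs : ∀ i : ℕ, s i = Algebra.trace (ZMod 2) F (β * α ^ i)) :
    code m d e k S s = LinearMap.range (encode m J α) := by
  classical
  have hN : NeZero (2 ^ m - 1) := ⟨by
    have := Nat.pow_le_pow_right (n := 2) (by norm_num) hm
    omega⟩
  have hαN : α ^ (2 ^ m - 1) = 1 := by
    rw [← hF]; exact FiniteField.pow_card_sub_one_eq_one α hα0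
  have hshift : ∀ t : ℕ, shift (t : ZMod (2 ^ m - 1)) s = encode m J α (β * α ^ t, 0) := by
    intro t
    funext i
    have := hs (i.val + t)
    push_cast at this
    rw [ZMod.natCast_val, ZMod.cast_id] at this
    rw [shift, this, encode_apply]
    congr 1
    simp [phase]
    ring
  have hdec : ∀ (t : ℕ) (j : Fin (k - 1)),
      shift (t : ZMod (2 ^ m - 1)) (decimate (S.factor m d e (j.1 + 1)) s) =
        encode m J α (0, Pi.single j (β * (α ^ t) ^ S.factor m d e (j.1 + 1))) := by
    intro t j
    funext i
    have := hs (S.factor m d e (j.1 + 1) * (i.val + t))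
    push_cast at this
    rw [ZMod.natCast_val, ZMod.cast_id] at this
    rw [shift, decimate, this, encode_apply]
    congr 1
    simp only [phase, hJf]
    rw [Fintype.sum_eq_single j]
    · rw [Pi.single_eq_same]
      ring
    · intro l hl
      rw [Pi.single_eq_of_ne hl, zero_mul]
  apply le_antisymm
  · refine Submodule.span_le.2 ?_
    rintro c (⟨t, rfl⟩ | ⟨t, j, hj1, hj2, rfl⟩)
    · rw [← ZMod.natCast_zmod_val t, hshift]
      exact LinearMap.mem_range_self _ _
    · have := hdec t.val ⟨j - 1, by omega⟩
      rw [ZMod.natCast_zmod_val] at this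
      simp only [Nat.sub_add_cancel hj1] at this
      rw [this]
      exact LinearMap.mem_range_self _ _
  · rintro _ ⟨⟨b₀, b⟩, rfl⟩
    have hsplit : ((b₀, b) : F × (Fin (k - 1) → F)) = (b₀, 0) + ∑ j, (0, Pi.single j (b j)) := by
      ext j
      · simp [Prod.fst_sum]
      · simp [Prod.snd_sum, Finset.sum_apply]
    rw [hsplit, map_add, map_sum]
    refine Submodule.add_mem _ ?_ (Submodule.sum_mem _ fun j _ => ?_)
    · by_cases hb : b₀ = 0
      · rw [hb]
        change encode m J α 0 ∈ _
        rw [map_zero]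
        exact Submodule.zero_mem _
      · obtain ⟨t, ht⟩ := hα (b₀ / β) (div_ne_zero hb hβ)
        rw [div_eq_iff hβ] at ht
        rw [ht, mul_comm, ← hshift]
        exact Submodule.subset_span (Or.inl ⟨_, rfl⟩)
    · by_cases hb : b j = 0
      · rw [hb, Pi.single_zero]
        change encode m J α 0 ∈ _
        rw [map_zero]
        exact Submodule.zero_mem _
      -- Every nonzero `b j` must be `β` times `y * J j y` for some `y`; bijectivity of `y ↦ y * J j
      -- y` in odd degree provides it.
      · have hsurj := Finite.surjective_of_injective (mul_galois_injective hJ.odd_finrank (J j))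
        obtain ⟨y, hy⟩ := hsurj (b j / β)
        simp only at hy
        have hy0 : y ≠ 0 := by
          rintro rfl
          rw [zero_mul] at hy
          exact div_ne_zero hb hβ hy.symm
        obtain ⟨t, rfl⟩ := hα y hy0
        rw [hJf, eq_div_iff hβ, mul_comm] at hy
        rw [← hy, ← hdec]
        exact Submodule.subset_span (Or.inr ⟨_, j.1 + 1, by omega, by omega, rfl⟩)

end Code

/-- The exact number of balanced codewords. -/
lemma balancedCount_eq {m d e k : ℕ} (h : Parameters m d e k) (S : System) {s : BinSeq m}
    (hs : IsMaxLength m s) :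
    (balancedCount m d e k S s : ℝ) = ((2 : ℝ) ^ m) ^ k - 1 -
      ∑ u ∈ range (k - 1), (-1) ^ u * (((2 : ℝ) ^ e) ^ ((u + 1) ^ 2))⁻¹ *
        (((2 : ℝ) ^ m) ^ (k - u) - 2 ^ m) *
        ∏ j ∈ range u, ((2 : ℝ) ^ m - (2 ^ e) ^ (2 * j + 1)) := by
  classical
  have hm : 2 ≤ m := by
    obtain ⟨t, hm, hkt, he, -⟩ := h.exists_odd
    have := h.two_le
    rw [hm]
    nlinarith
  obtain ⟨F, _, _, _, α, β, hF, hβ, hα0, hα, hsα⟩ := exists_field_of_isMaxLength hm hs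
  obtain ⟨K, ρ, J, hK, hJ, hJf⟩ := exists_goldFamily h hF S
  have hchar : CharP F 2 := charP_of_injective_algebraMap (algebraMap (ZMod 2) F).injective 2
  have : Fintype K := Fintype.ofFinite K
  have hcode := code_eq_range_encode (d := d) (e := e) hJ hJf hm hF hα0 hβ hα hsα
  have hset : {c : BinSeq m | c ∈ code m d e k S s ∧ dc c = -1} =
      encode m J α '' (({p : F × (Fin (k - 1) → F) | expSum (traceChar F) J p.1 p.2 = 0} :
        Finset _) : Set (F × (Fin (k - 1) → F))) := by
    ext c
    simp only [Set.mem_ofPred_eq, hcode, LinearMap.mem_range, coe_filter, mem_univ, true_and,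
      Set.mem_image]
    constructor
    · rintro ⟨⟨p, rfl⟩, hp⟩
      rw [dc_encode hm hF hα0 hα] at hp
      exact ⟨p, by omega, rfl⟩
    · rintro ⟨p, hp, rfl⟩
      refine ⟨⟨p, rfl⟩, ?_⟩
      rw [dc_encode hm hF hα0 hα, hp, zero_sub]
  have hcard := card_expSum_eq_zero hJ traceChar_isPrimitive (traceChar_galois K)
  rw [balancedCount, hset, Set.ncard_image_of_injective _ (encode_injective hJ hF hα0 hα),
    Set.ncard_coe_finset]
  rw [Nat.card_eq_fintype_card] at hK
  rw [hF, hK] at hcard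
  push_cast at hcard
  exact hcard

end GoldType

/-! ### Uniform asymptotic estimates. -/

namespace GoldType

open Finset

section Asymptotics

/-- The lower bound is the union-type bound `∏ (1 - a_j) ≥ 1 - ∑ a_j`, with the sum of odd powers
absorbed into `q^(2u)` through `1 + q ≤ q²`. -/
lemma prod_one_sub_bounds {q X : ℝ} (hq : 2 ≤ q) (hX : 0 < X) (u : ℕ)
    (h : ∀ j < u, q ^ (2 * j + 1) ≤ X) :
    0 ≤ ∏ j ∈ range u, (1 - q ^ (2 * j + 1) / X) ∧
      ∏ j ∈ range u, (1 - q ^ (2 * j + 1) / X) ≤ 1 ∧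
      1 - q ^ (2 * u) / X ≤ ∏ j ∈ range u, (1 - q ^ (2 * j + 1) / X) := by
  induction u with
  | zero => simp [hX.le]
  | succ u ih =>
    obtain ⟨h1, h2, h3⟩ := ih fun j hj => h j (by omega)
    rw [prod_range_succ]
    have hle : q ^ (2 * u + 1) / X ≤ 1 := (div_le_one hX).2 (h u (by omega))
    have hnn : 0 ≤ q ^ (2 * u + 1) / X := by positivity
    have hq' : q ^ (2 * u) / X + q ^ (2 * u + 1) / X ≤ q ^ (2 * (u + 1)) / X := by
      rw [← add_div]
      gcongr
      rw [show 2 * (u + 1) = 2 * u + 2 by ring, pow_add q (2 * u) 2, pow_succ q (2 * u)]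
      have hqq : 1 + q ≤ q ^ 2 := by nlinarith
      calc q ^ (2 * u) + q ^ (2 * u) * q = q ^ (2 * u) * (1 + q) := by ring
        _ ≤ q ^ (2 * u) * q ^ 2 := by gcongr
    refine ⟨mul_nonneg h1 (by linarith), ?_, ?_⟩
    · nlinarith
    · nlinarith

lemma sum_inv_pow_sq_le {q : ℝ} (hq : 2 ≤ q) (N : ℕ) :
    ∑ u ∈ range N, (q ^ ((u + 1) ^ 2))⁻¹ ≤ 5 / 8 := by
  rcases N with _ | N
  · norm_num
  -- The first term is at most `1/2`; the later ones are dominated by the geometric series `1/16 +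
  -- 1/32 + ⋯ = 1/8`.
  suffices h : ∑ u ∈ range (N + 1), (q ^ ((u + 1) ^ 2))⁻¹ ≤ 5 / 8 - (2 ^ (N + 3))⁻¹ by
    have : (0 : ℝ) < (2 ^ (N + 3))⁻¹ := by positivity
    linarith
  induction N with
  | zero =>
    have : q⁻¹ ≤ 2⁻¹ := by gcongr
    norm_num at this ⊢
    linarith
  | succ N ih =>
    rw [sum_range_succ]
    have h1 : (q ^ ((N + 1 + 1) ^ 2))⁻¹ ≤ ((2 : ℝ) ^ (N + 4))⁻¹ := by
      gcongr
      calc (2 : ℝ) ^ (N + 4) ≤ 2 ^ ((N + 1 + 1) ^ 2) := by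
            gcongr
            · norm_num
            · nlinarith
        _ ≤ q ^ ((N + 1 + 1) ^ 2) := by gcongr
    have h2 : ((2 : ℝ) ^ (N + 3))⁻¹ = 2 * (2 ^ (N + 4))⁻¹ := by
      rw [pow_succ _ (N + 3)]; field_simp
    rw [show N + 1 + 3 = N + 4 by ring]
    linarith

lemma sum_geom_half_le (N : ℕ) : ∑ u ∈ range N, ((2 : ℝ) ^ u)⁻¹ ≤ 2 := by
  suffices h : ∑ u ∈ range N, ((2 : ℝ) ^ u)⁻¹ = 2 - 2 * (2 ^ N)⁻¹ by
    have : (0 : ℝ) < (2 ^ N)⁻¹ := by positivity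
    linarith
  induction N with
  | zero => norm_num
  | succ N ih =>
    rw [sum_range_succ, ih, pow_succ]
    field_simp
    ring

lemma abs_count_div_sub_le {q X : ℝ} (hq : 2 ≤ q) (hX : 1 ≤ X) {k : ℕ} (hk : 2 ≤ k)
    (hqX : ∀ j < k - 2, q ^ (2 * j + 1) ≤ X) :
    |(X ^ k - 1 - ∑ u ∈ range (k - 1), (-1) ^ u * (q ^ ((u + 1) ^ 2))⁻¹ * (X ^ (k - u) - X) *
        ∏ j ∈ range u, (X - q ^ (2 * j + 1))) / X ^ k -
      (1 - ∑ u ∈ range (k - 1), (-1) ^ u * (q ^ ((u + 1) ^ 2))⁻¹)| ≤ 3 / X := by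
  have hX0 : 0 < X := by linarith
  have hsplit : (X ^ k - 1 - ∑ u ∈ range (k - 1), (-1) ^ u * (q ^ ((u + 1) ^ 2))⁻¹ *
        (X ^ (k - u) - X) * ∏ j ∈ range u, (X - q ^ (2 * j + 1))) / X ^ k -
      (1 - ∑ u ∈ range (k - 1), (-1) ^ u * (q ^ ((u + 1) ^ 2))⁻¹) =
      -(X ^ k)⁻¹ + ∑ u ∈ range (k - 1), (-1) ^ u * (q ^ ((u + 1) ^ 2))⁻¹ *
        (1 - (1 - (X ^ (k - 1 - u))⁻¹) * ∏ j ∈ range u, (1 - q ^ (2 * j + 1) / X)) := by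
    have hterm : ∀ u ∈ range (k - 1), (-1) ^ u * (q ^ ((u + 1) ^ 2))⁻¹ *
        (1 - (1 - (X ^ (k - 1 - u))⁻¹) * ∏ j ∈ range u, (1 - q ^ (2 * j + 1) / X)) =
        (-1) ^ u * (q ^ ((u + 1) ^ 2))⁻¹ - ((-1) ^ u * (q ^ ((u + 1) ^ 2))⁻¹ *
        (X ^ (k - u) - X) * ∏ j ∈ range u, (X - q ^ (2 * j + 1))) / X ^ k := by
      intro u hu
      have hu' := mem_range.1 hu
      have h1 : ∏ j ∈ range u, (X - q ^ (2 * j + 1)) =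
          X ^ u * ∏ j ∈ range u, (1 - q ^ (2 * j + 1) / X) := by
        rw [← card_range u, ← prod_const, card_range, ← prod_mul_distrib]
        exact prod_congr rfl fun j _ => by field_simp
      have h2 : X ^ k = X * X ^ (k - 1 - u) * X ^ u := by
        rw [← pow_succ', ← pow_add]; congr 1; omega
      have h3 : X ^ (k - u) = X * X ^ (k - 1 - u) := by
        rw [← pow_succ']; congr 1; omega
      rw [h1, h2, h3]
      field_simp
    rw [sum_congr rfl hterm, sum_sub_distrib, ← sum_div]
    field_simp
    ring
  rw [hsplit]
  have h1 : |(-(X ^ k)⁻¹ : ℝ)| ≤ 1 / X := by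
    rw [abs_neg, abs_of_pos (by positivity), one_div]
    gcongr
    exact le_self_pow₀ hX (by omega)
  have h2 : ∀ u ∈ range (k - 1), |(-1) ^ u * (q ^ ((u + 1) ^ 2))⁻¹ *
        (1 - (1 - (X ^ (k - 1 - u))⁻¹) * ∏ j ∈ range u, (1 - q ^ (2 * j + 1) / X))| ≤
        (2 ^ u)⁻¹ / X := by
    intro u hu
    have hu' := mem_range.1 hu
    obtain ⟨p1, p2, p3⟩ := prod_one_sub_bounds hq hX0 u fun j hj => hqX j (by omega)
    set P := ∏ j ∈ range u, (1 - q ^ (2 * j + 1) / X)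
    have hy : (X ^ (k - 1 - u))⁻¹ ≤ 1 / X := by
      rw [one_div]
      gcongr
      exact le_self_pow₀ hX (by omega)
    have hy0 : 0 < (X ^ (k - 1 - u))⁻¹ := by positivity
    have hX1 : 1 / X ≤ 1 := (div_le_one hX0).2 hX
    rw [abs_mul, abs_mul, abs_pow, abs_neg, abs_one, one_pow, one_mul,
      abs_of_pos (by positivity : 0 < (q ^ ((u + 1) ^ 2))⁻¹), abs_of_nonneg (by nlinarith)]
    have hbd : 1 - (1 - (X ^ (k - 1 - u))⁻¹) * P ≤ 2 * q ^ (2 * u) / X := by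
      have : 1 ≤ q ^ (2 * u) := one_le_pow₀ (by linarith)
      have : 1 / X ≤ q ^ (2 * u) / X := by gcongr
      have : 2 * q ^ (2 * u) / X = q ^ (2 * u) / X + q ^ (2 * u) / X := by ring
      nlinarith
    -- The Gaussian weight `q^(-(u+1)²)` beats the error `2 q^(2u) / X` and leaves `2^(-u) / X`,
    -- summable independently of `k`.
    have hpow : 2 * q ^ (2 * u) * 2 ^ u ≤ q ^ ((u + 1) ^ 2) := by
      rw [show (u + 1) ^ 2 = 2 * u + (u ^ 2 + 1) by ring, pow_add]
      have : (2 : ℝ) * 2 ^ u ≤ q ^ (u ^ 2 + 1) := by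
        calc (2 : ℝ) * 2 ^ u = 2 ^ (u + 1) := by ring
          _ ≤ 2 ^ (u ^ 2 + 1) := by
            gcongr
            · norm_num
            · nlinarith
          _ ≤ q ^ (u ^ 2 + 1) := by gcongr
      have h0 : 0 ≤ q ^ (2 * u) := by positivity
      nlinarith
    calc (q ^ ((u + 1) ^ 2))⁻¹ * (1 - (1 - (X ^ (k - 1 - u))⁻¹) * P)
        ≤ (q ^ ((u + 1) ^ 2))⁻¹ * (2 * q ^ (2 * u) / X) := by gcongr
      _ = (q ^ ((u + 1) ^ 2))⁻¹ * (2 * q ^ (2 * u) * 2 ^ u) * (2 ^ u)⁻¹ / X := by field_simp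
      _ ≤ (q ^ ((u + 1) ^ 2))⁻¹ * (q ^ ((u + 1) ^ 2)) * (2 ^ u)⁻¹ / X := by gcongr
      _ = (2 ^ u)⁻¹ / X := by field_simp
  calc _ ≤ |(-(X ^ k)⁻¹ : ℝ)| + ∑ u ∈ range (k - 1), (2 ^ u)⁻¹ / X :=
        (abs_add_le _ _).trans (add_le_add_right ((abs_sum_le_sum_abs _ _).trans
          (sum_le_sum h2)) _)
    _ ≤ 1 / X + 2 / X := by
        rw [← sum_div]
        gcongr
        exact sum_geom_half_le _
    _ = 3 / X := by ring

end Asymptotics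

end GoldType

/-! ### The exact count and its uniform limit. -/

theorem theorem1p3 :
    (∀ (m d e k : ℕ), GoldType.Parameters m d e k →
      ∀ (S : GoldType.System) (s : GoldType.BinSeq m), GoldType.IsMaxLength m s →
        (GoldType.balancedCount m d e k S s : ℝ) =
          2 ^ (m * k) - 1 -
            ∑ u ∈ Finset.range (k - 1),
              (-1 : ℝ) ^ u * (2 : ℝ) ^ (-((e * (u + 1) ^ 2 : ℕ) : ℤ)) *
                ((2 : ℝ) ^ (m * (k - u)) - 2 ^ m) *
                ∏ j ∈ Finset.range u, ((2 : ℝ) ^ m - 2 ^ (e * (2 * j + 1)))) ∧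
    (∀ ε : ℝ, 0 < ε → ∃ m₀ : ℕ, ∀ (m d e k : ℕ), m₀ ≤ m → GoldType.Parameters m d e k →
      ∀ (S : GoldType.System) (s : GoldType.BinSeq m), GoldType.IsMaxLength m s →
        |(GoldType.balancedCount m d e k S s : ℝ) /
            (2 ^ (m * k) *
              (1 - ∑ u ∈ Finset.range (k - 1),
                (-1 : ℝ) ^ u * (2 : ℝ) ^ (-((e * (u + 1) ^ 2 : ℕ) : ℤ)))) - 1| ≤ ε) := by
  have hz : ∀ e u : ℕ, (2 : ℝ) ^ (-((e * (u + 1) ^ 2 : ℕ) : ℤ)) =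
      (((2 : ℝ) ^ e) ^ ((u + 1) ^ 2))⁻¹ := by
    intro e u
    rw [zpow_neg, zpow_natCast, pow_mul]
  constructor
  · intro m d e k h S s hs
    rw [GoldType.balancedCount_eq h S hs]
    simp only [hz, pow_mul]
  · intro ε hε
    -- The relative error is at most `(3 / 2^m) / (3/8) = 8 / 2^m`.
    obtain ⟨m₀, hm₀⟩ := exists_nat_ge (8 / ε)
    refine ⟨m₀, fun m d e k hm h S s hs => ?_⟩
    rw [GoldType.balancedCount_eq h S hs]
    simp only [hz, pow_mul]
    obtain ⟨t, hmt, hkt, he, -⟩ := h.exists_odd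
    have hq : (2 : ℝ) ≤ 2 ^ e := le_self_pow₀ (by norm_num) he.ne'
    have hX : (1 : ℝ) ≤ 2 ^ m := one_le_pow₀ (by norm_num)
    have hqX : ∀ j < k - 2, ((2 : ℝ) ^ e) ^ (2 * j + 1) ≤ 2 ^ m := by
      intro j hj
      rw [← pow_mul, hmt]
      gcongr
      · norm_num
      · omega
    have hmain := GoldType.abs_count_div_sub_le hq hX h.two_le hqX
    have hD : 3 / 8 ≤ 1 - ∑ u ∈ Finset.range (k - 1), (-1 : ℝ) ^ u *
        (((2 : ℝ) ^ e) ^ ((u + 1) ^ 2))⁻¹ := by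
      have h1 := GoldType.sum_inv_pow_sq_le hq (k - 1)
      have h2 : ∑ u ∈ Finset.range (k - 1), (-1 : ℝ) ^ u * (((2 : ℝ) ^ e) ^ ((u + 1) ^ 2))⁻¹ ≤
          ∑ u ∈ Finset.range (k - 1), (((2 : ℝ) ^ e) ^ ((u + 1) ^ 2))⁻¹ := by
        refine Finset.sum_le_sum fun u _ => ?_
        have h3 : (-1 : ℝ) ^ u ≤ 1 := by
          rcases neg_one_pow_eq_or ℝ u with h | h <;> rw [h]
          norm_num
        exact mul_le_of_le_one_left (by positivity) h3
      linarith
    set D := 1 - ∑ u ∈ Finset.range (k - 1), (-1 : ℝ) ^ u * (((2 : ℝ) ^ e) ^ ((u + 1) ^ 2))⁻¹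
    have hD0 : 0 < D := by linarith
    rw [← div_div, div_sub_one hD0.ne', abs_div, abs_of_pos hD0, div_le_iff₀ hD0]
    refine hmain.trans ?_
    have h8 : 8 / ε ≤ 2 ^ m := by
      refine hm₀.trans ((Nat.cast_le.2 hm).trans ?_)
      exact_mod_cast (Nat.lt_two_pow_self (n := m)).le
    rw [div_le_iff₀ hε] at h8
    rw [div_le_iff₀ (by linarith)]
    nlinarith
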